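/- **Theorem 5.1 (contact-type obstruction).** Let $n\ge 1$ and let $M$ be a non-empty closed (compact, without boundary, Hausdorff) smooth manifold of dimension $2n+1$. All forms are smooth. A *contact form* on $M$ is a 1-form $\lambda$ such that $\lambda\wedge(d\lambda)^n$ vanishes nowhere. A *presymplectic form* on $M$ is a closed 2-form $\omega$ of rank $2n$ at every point; its *Reeb foliation* $\mathfrak R_\omega$ is the one-dimensional foliation tangent to the line bundle $\{V\in TM : \iota_V\omega=0\}$. By the *Reeb foliation of a contact form* $\lambda$ we mean that of the (automatically presymplectic) form $d\lambda$, namely $\mathfrak R_{d\lambda}$. A 2-form is *of contact type* if it equals $d\lambda$ for some contact form $\lambda$. For a foliation $\mathfrak F$ of $M$ put $$\Omega^k_b(M,\mathfrak F)=\{\alpha\in\Omega^k(M) : \iota_X\alpha=\iota_X d\alpha=0 \text{ for all } X\in T\mathfrak F\},$$ and let $H^*_b(M,\mathfrak F)$ be the cohomology of the complex $(\Omega^*_b(M,\mathfrak F),d)$ (basic cohomology). Every presymplectic form $\omega$ is a cocycle in $\Omega^2_b(M,\mathfrak R_\omega)$; its class in $H^2_b(M,\mathfrak R_\omega)$ is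 its *basic class*. 1. If $\lambda$ is a contact form on $M$ with Reeb foliation $\mathfrak R=\mathfrak R_{d\lambda}$, then $[d\lambda]\ne 0$ in $H^2_b(M,\mathfrak R)$. 2. Hence, if $\omega$ is a presymplectic form on $M$ whose basic class in $H^2_b(M,\mathfrak R_\omega)$ is zero, then $\omega$ is not of contact type. -/

import Mathlib

open scoped Manifold ContDiff Topology

noncomputable section

namespace Presymplectic

section Forms

variable (E : Type*) [NormedAddCommGroup E] [NormedSpace ℝ E]
  (M : Type*) [TopologicalSpace M] [ChartedSpace E M]

/-- A field of alternating `k`-linear forms on the tangent spaces of `M`, with no regularity. -/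
def FormField (k : ℕ) : Type _ :=
  (x : M) → TangentSpace 𝓘(ℝ, E) x [⋀^Fin k]→L[ℝ] ℝ

instance (k : ℕ) : AddCommGroup (FormField E M k) :=
  inferInstanceAs (AddCommGroup ((x : M) → TangentSpace 𝓘(ℝ, E) x [⋀^Fin k]→L[ℝ] ℝ))

instance (k : ℕ) : Module ℝ (FormField E M k) :=
  inferInstanceAs (Module ℝ ((x : M) → TangentSpace 𝓘(ℝ, E) x [⋀^Fin k]→L[ℝ] ℝ))

variable {E M} {k : ℕ}

/-- The expression of `a` in the chart around `p`: the pullback of `a` by the inverse chart.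
It is meaningful on the target of the chart. -/
def FormField.inChart (a : FormField E M k) (p : M) (y : E) : E [⋀^Fin k]→L[ℝ] ℝ :=
  ContinuousAlternatingMap.compContinuousLinearMap (a ((chartAt E p).symm y))
    (mfderiv 𝓘(ℝ, E) 𝓘(ℝ, E) (chartAt E p).symm y)

/-- `a` is smooth if its expression in each of the charts that make up the atlas is smooth. -/
def FormField.IsSmooth (a : FormField E M k) : Prop :=
  ∀ p : M, ContDiffOn ℝ ∞ (a.inChart p) (chartAt E p).target

/-- The exterior derivative, computed at `x` in the preferred chart around `x`. That it is given by
the same formula in every chart is `FormField.inChart_d` below. -/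
def FormField.d (a : FormField E M k) : FormField E M (k + 1) := fun x ↦
  ContinuousAlternatingMap.compContinuousLinearMap
    (extDeriv (a.inChart x) (chartAt E x x))
    (mfderiv 𝓘(ℝ, E) 𝓘(ℝ, E) (chartAt E x) x)

theorem FormField.inChart_add (a b : FormField E M k) (p : M) :
    (a + b).inChart p = a.inChart p + b.inChart p := rfl

theorem FormField.inChart_smul (c : ℝ) (a : FormField E M k) (p : M) :
    (c • a).inChart p = c • a.inChart p := rfl

theorem FormField.inChart_zero (p : M) : (0 : FormField E M k).inChart p = 0 := rfl

theorem FormField.IsSmooth.differentiableAt {a : FormField E M k} (ha : a.IsSmooth) {p : M} {y : E}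
    (hy : y ∈ (chartAt E p).target) : DifferentiableAt ℝ (a.inChart p) y :=
  ((ha p).contDiffAt ((chartAt E p).open_target.mem_nhds hy)).differentiableAt (by simp)

theorem FormField.d_add {a b : FormField E M k} (ha : a.IsSmooth) (hb : b.IsSmooth) :
    (a + b).d = a.d + b.d := by
  funext x
  have hx := mem_chart_target E x
  simp only [FormField.d, FormField.inChart_add]
  rw [extDeriv_add (ha.differentiableAt hx) (hb.differentiableAt hx)]
  rfl

theorem FormField.d_smul (c : ℝ) (a : FormField E M k) : (c • a).d = c • a.d := by
  funext x
  simp only [FormField.d, FormField.inChart_smul]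
  rw [extDeriv_smul]
  rfl

/-- Pullback of a field of forms by a map defined on `E`, an auxiliary notion for the two lemmas
below. -/
def FormField.pull (a : FormField E M k) (f : E → M) (y : E) : E [⋀^Fin k]→L[ℝ] ℝ :=
  ContinuousAlternatingMap.compContinuousLinearMap (a (f y)) (mfderiv 𝓘(ℝ, E) 𝓘(ℝ, E) f y)

theorem FormField.pull_congr (a : FormField E M k) {f g : E → M} {y : E}
    (h : f =ᶠ[𝓝 y] g) : a.pull f y = a.pull g y := by
  have hA : ∀ z w : M, z = w →
      (a z : E [⋀^Fin k]→L[ℝ] ℝ) = (a w : E [⋀^Fin k]→L[ℝ] ℝ) := by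
    rintro z _ rfl; rfl
  have h1 : (mfderiv 𝓘(ℝ, E) 𝓘(ℝ, E) f y : E →L[ℝ] E) = mfderiv 𝓘(ℝ, E) 𝓘(ℝ, E) g y := h.mfderiv_eq
  have h2 := hA _ _ h.eq_of_nhds
  exact congrArg₂ (fun (u : E [⋀^Fin k]→L[ℝ] ℝ) (l : E →L[ℝ] E) =>
    u.compContinuousLinearMap l) h2 h1

theorem two_le_infty : minSmoothness ℝ 2 ≤ (∞ : WithTop ℕ∞) := by
  rw [minSmoothness_of_isRCLikeNormedField]
  exact WithTop.coe_le_coe.2 le_top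

section Smooth

variable [IsManifold 𝓘(ℝ, E) ∞ M]

theorem transition_contDiffAt (p q : M) {y : E} (hy : y ∈ (chartAt E p).target)
    (hq : (chartAt E p).symm y ∈ (chartAt E q).source) :
    ContDiffAt ℝ ∞ (chartAt E q ∘ (chartAt E p).symm) y := by
  have h := contDiffWithinAt_ext_coord_change (I := 𝓘(ℝ, E)) (n := ∞) q p (y := y)
    (by simp [hy, hq])
  simpa [contDiffWithinAt_univ] using h

theorem FormField.inChart_transition (a : FormField E M k) (p q : M) {y : E}
    (hy : y ∈ (chartAt E p).target) (hq : (chartAt E p).symm y ∈ (chartAt E q).source) :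
    a.inChart p y =
      (a.inChart q ((chartAt E q ∘ (chartAt E p).symm) y)).compContinuousLinearMap
        (fderiv ℝ (chartAt E q ∘ (chartAt E p).symm) y) := by
  set T := chartAt E q ∘ (chartAt E p).symm with hT
  have hev : (chartAt E p).symm =ᶠ[𝓝 y] (chartAt E q).symm ∘ T := by
    have hn : (chartAt E p).target ∩ (chartAt E p).symm ⁻¹' (chartAt E q).source ∈ 𝓝 y :=
      ((chartAt E p).isOpen_inter_preimage_symm (chartAt E q).open_source).mem_nhds ⟨hy, hq⟩
    filter_upwards [hn] with w hw
    simp [hT, (chartAt E q).left_inv hw.2]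
  have hTy : T y ∈ (chartAt E q).target := (chartAt E q).map_source hq
  have hTd : MDifferentiableAt 𝓘(ℝ, E) 𝓘(ℝ, E) T y :=
    ((transition_contDiffAt p q hy hq).differentiableAt (by simp)).mdifferentiableAt
  have hs : MDifferentiableAt 𝓘(ℝ, E) 𝓘(ℝ, E) (chartAt E q).symm (T y) :=
    mdifferentiableAt_atlas_symm (chart_mem_atlas E q) hTy
  have hc := mfderiv_comp y hs hTd
  have h1 : a.inChart p y = a.pull ((chartAt E q).symm ∘ T) y := a.pull_congr hev
  rw [h1, FormField.pull, hc, mfderiv_eq_fderiv]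
  rfl

/-- In every chart the exterior derivative is the usual one. -/
theorem FormField.inChart_d {a : FormField E M k} (ha : a.IsSmooth) (p : M) {y : E}
    (hy : y ∈ (chartAt E p).target) : a.d.inChart p y = extDeriv (a.inChart p) y := by
  set q := (chartAt E p).symm y with hqdef
  have hq : (chartAt E p).symm y ∈ (chartAt E q).source := mem_chart_source E q
  set T := chartAt E q ∘ (chartAt E p).symm with hT
  have hTs := transition_contDiffAt p q hy hq
  have hTy : T y ∈ (chartAt E q).target := (chartAt E q).map_source hq
  have hev : a.inChart p =ᶠ[𝓝 y]
      fun w ↦ (a.inChart q (T w)).compContinuousLinearMap (fderiv ℝ T w) := by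
    have hn : (chartAt E p).target ∩ (chartAt E p).symm ⁻¹' (chartAt E q).source ∈ 𝓝 y :=
      ((chartAt E p).isOpen_inter_preimage_symm (chartAt E q).open_source).mem_nhds ⟨hy, hq⟩
    filter_upwards [hn] with w hw
    exact a.inChart_transition p q hw.1 hw.2
  rw [hev.extDeriv_eq, extDeriv_pullback (r := ∞) (ha.differentiableAt hTy) hTs two_le_infty]
  have hd : MDifferentiableAt 𝓘(ℝ, E) 𝓘(ℝ, E) (chartAt E q) ((chartAt E p).symm y) :=
    mdifferentiableAt_atlas (chart_mem_atlas E q) hq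
  have hs : MDifferentiableAt 𝓘(ℝ, E) 𝓘(ℝ, E) (chartAt E p).symm y :=
    mdifferentiableAt_atlas_symm (chart_mem_atlas E p) hy
  have hc := mfderiv_comp y hd hs
  rw [mfderiv_eq_fderiv] at hc
  rw [hc]
  rfl

theorem FormField.IsSmooth.d {a : FormField E M k} (ha : a.IsSmooth) : a.d.IsSmooth := by
  intro p
  have h1 : ContDiffOn ℝ ∞ (fderiv ℝ (a.inChart p)) (chartAt E p).target :=
    (ha p).fderiv_of_isOpen (chartAt E p).open_target (by simp)
  have h2 : ContDiffOn ℝ ∞ (extDeriv (a.inChart p)) (chartAt E p).target :=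
    ContDiff.comp_contDiffOn (g := ContinuousAlternatingMap.alternatizeUncurryFinCLM ℝ E ℝ)
      (ContinuousLinearMap.contDiff _) h1
  exact h2.congr fun y hy ↦ FormField.inChart_d ha p hy

theorem FormField.d_d {a : FormField E M k} (ha : a.IsSmooth) : a.d.d = 0 := by
  funext x
  have hx := mem_chart_target E x
  have hev : a.d.inChart x =ᶠ[𝓝 (chartAt E x x)] extDeriv (a.inChart x) := by
    filter_upwards [(chartAt E x).open_target.mem_nhds hx] with y hy
    exact FormField.inChart_d ha x hy
  have h0 : extDeriv (a.d.inChart x) (chartAt E x x) = 0 := by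
    rw [hev.extDeriv_eq]
    exact extDeriv_extDeriv_apply ((ha x).contDiffAt ((chartAt E x).open_target.mem_nhds hx))
      two_le_infty
  rw [FormField.d, h0]
  rfl

end Smooth

variable (E M) in
/-- The space `Ω^k(M)` of smooth differential `k`-forms on `M`. -/
def DiffForm (k : ℕ) : Submodule ℝ (FormField E M k) where
  carrier := {a | a.IsSmooth}
  add_mem' ha hb p := (ha p).add (hb p)
  zero_mem' _ := contDiffOn_const (c := (0 : E [⋀^Fin k]→L[ℝ] ℝ))
  smul_mem' c _ ha p := (ha p).const_smul c

/-- `ι_X a = 0` for every vector `X` in `F`: since `a` is alternating, this says that `a` vanishes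
as soon as one of its arguments is in `F`. No condition for functions (`k = 0`). -/
def FormField.IsHorizontal (F : (x : M) → Submodule ℝ (TangentSpace 𝓘(ℝ, E) x))
    (a : FormField E M k) : Prop :=
  ∀ (x : M) (v : Fin k → TangentSpace 𝓘(ℝ, E) x), (∃ i, v i ∈ F x) → a x v = 0

theorem FormField.IsHorizontal.add {F : (x : M) → Submodule ℝ (TangentSpace 𝓘(ℝ, E) x)}
    {a b : FormField E M k} (ha : a.IsHorizontal F) (hb : b.IsHorizontal F) :
    (a + b).IsHorizontal F := fun x v hv ↦ by
  have h : (a x) v + (b x) v = 0 := by rw [ha x v hv, hb x v hv, add_zero]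
  exact h

theorem FormField.IsHorizontal.smul {F : (x : M) → Submodule ℝ (TangentSpace 𝓘(ℝ, E) x)}
    (c : ℝ) {a : FormField E M k} (ha : a.IsHorizontal F) : (c • a).IsHorizontal F :=
  fun x v hv ↦ by
  have h : c • (a x) v = 0 := by rw [ha x v hv, smul_zero]
  exact h

theorem FormField.IsHorizontal.zero {F : (x : M) → Submodule ℝ (TangentSpace 𝓘(ℝ, E) x)} :
    (0 : FormField E M k).IsHorizontal F := fun _ _ _ ↦ rfl

/-- The map `V ↦ ι_V w` given by a 2-form `w` at the point `x`. -/
def contraction (w : DiffForm E M 2) (x : M) :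
    TangentSpace 𝓘(ℝ, E) x →ₗ[ℝ] TangentSpace 𝓘(ℝ, E) x [⋀^Fin 1]→ₗ[ℝ] ℝ :=
  (w.1 x).toAlternatingMap.curryLeft

/-- The Reeb bundle of a 2-form `w`, which consists of the vectors `V` with `ι_V w = 0`. If `w` is
presymplectic it is the tangent bundle of the Reeb foliation of `w`. -/
def reebBundle (w : DiffForm E M 2) (x : M) : Submodule ℝ (TangentSpace 𝓘(ℝ, E) x) :=
  LinearMap.ker (contraction w x)

theorem isHorizontal_reebBundle (w : DiffForm E M 2) : w.1.IsHorizontal (reebBundle w) := by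
  have key : ∀ (x : M) (V : TangentSpace 𝓘(ℝ, E) x), V ∈ reebBundle w x →
      ∀ v : Fin 2 → TangentSpace 𝓘(ℝ, E) x, v 0 = V → w.1 x v = 0 := by
    rintro x V hV v rfl
    have h : contraction w x (v 0) (Matrix.vecTail v) = 0 := by
      rw [show contraction w x (v 0) = 0 from hV]; rfl
    have h2 : Matrix.vecCons (v 0) (Matrix.vecTail v) = v := Matrix.cons_head_tail v
    change w.1 x (Matrix.vecCons (v 0) (Matrix.vecTail v)) = 0 at h
    rwa [h2] at h
  rintro x v ⟨i, hi⟩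
  fin_cases i
  · exact key x _ hi v rfl
  · have h := (w.1 x).toAlternatingMap.map_swap v (i := 0) (j := 1) (by decide)
    have h0 : w.1 x (v ∘ Equiv.swap 0 1) = 0 := key x _ hi _ (by simp)
    have h1 : w.1 x (v ∘ Equiv.swap 0 1) = - w.1 x v := h
    linarith

variable [IsManifold 𝓘(ℝ, E) ∞ M]

/-- The exterior derivative `d : Ω^k(M) → Ω^(k+1)(M)`. -/
def DiffForm.d : DiffForm E M k →ₗ[ℝ] DiffForm E M (k + 1) where
  toFun a := ⟨a.1.d, FormField.IsSmooth.d a.2⟩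
  map_add' a b := Subtype.ext (FormField.d_add a.2 b.2)
  map_smul' c a := Subtype.ext (FormField.d_smul c a.1)

theorem DiffForm.d_d (a : DiffForm E M k) : DiffForm.d (DiffForm.d a) = 0 :=
  Subtype.ext (FormField.d_d a.2)

/-! ### Basic cohomology

A foliation enters the definition of its basic forms only through the spaces `F x` of vectors
tangent to it at `x`. -/

/-- The basic `k`-forms `Ω_b^k`: `ι_X a = 0` and `ι_X (d a) = 0` for all `X` in `F`. -/
def BasicForm (F : (x : M) → Submodule ℝ (TangentSpace 𝓘(ℝ, E) x)) (k : ℕ) :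
    Submodule ℝ (DiffForm E M k) where
  carrier := {a | a.1.IsHorizontal F ∧ (DiffForm.d a).1.IsHorizontal F}
  add_mem' ha hb := ⟨ha.1.add hb.1, by rw [map_add]; exact ha.2.add hb.2⟩
  zero_mem' := ⟨.zero, by rw [map_zero]; exact .zero⟩
  smul_mem' c _ ha := ⟨ha.1.smul c, by rw [map_smul]; exact ha.2.smul c⟩

/-- The exterior derivative maps `Ω_b^k` to `Ω_b^(k+1)`. -/
theorem BasicForm.d_mem {F : (x : M) → Submodule ℝ (TangentSpace 𝓘(ℝ, E) x)}
    {a : DiffForm E M k} (ha : a ∈ BasicForm F k) : DiffForm.d a ∈ BasicForm F (k + 1) :=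
  ⟨ha.2, by rw [DiffForm.d_d]; exact .zero⟩

/-- The kernel of `d : Ω_b^k → Ω_b^(k+1)`. -/
def basicCocycles (F : (x : M) → Submodule ℝ (TangentSpace 𝓘(ℝ, E) x)) (k : ℕ) :
    Submodule ℝ (DiffForm E M k) :=
  BasicForm F k ⊓ LinearMap.ker DiffForm.d

/-- The image of `d : Ω_b^(k-1) → Ω_b^k` (zero for `k = 0`). -/
def basicCoboundaries (F : (x : M) → Submodule ℝ (TangentSpace 𝓘(ℝ, E) x)) :
    (k : ℕ) → Submodule ℝ (DiffForm E M k)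
  | 0 => ⊥
  | k + 1 => (BasicForm F k).map DiffForm.d

theorem basicCoboundaries_le (F : (x : M) → Submodule ℝ (TangentSpace 𝓘(ℝ, E) x)) (k : ℕ) :
    basicCoboundaries F k ≤ basicCocycles F k := by
  cases k with
  | zero => exact bot_le
  | succ k =>
    rintro _ ⟨a, ha, rfl⟩
    exact ⟨BasicForm.d_mem ha, DiffForm.d_d a⟩

/-- The basic cohomology `H_b^k(M, F)`: basic cocycles modulo basic coboundaries. -/
abbrev BasicCohomology (F : (x : M) → Submodule ℝ (TangentSpace 𝓘(ℝ, E) x)) (k : ℕ) : Type _ :=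
  basicCocycles F k ⧸ (basicCoboundaries F k).submoduleOf (basicCocycles F k)

/-- The class in `H_b^k(M, F)` of a basic cocycle. -/
def basicClass (F : (x : M) → Submodule ℝ (TangentSpace 𝓘(ℝ, E) x))
    (a : DiffForm E M k) (ha : a ∈ basicCocycles F k) : BasicCohomology F k :=
  Submodule.Quotient.mk ⟨a, ha⟩

/-- A closed 2-form is a basic cocycle for its own Reeb bundle. -/
theorem mem_basicCocycles_reebBundle {w : DiffForm E M 2} (hw : DiffForm.d w = 0) :
    w ∈ basicCocycles (reebBundle w) 2 :=
  ⟨⟨isHorizontal_reebBundle w, by rw [hw]; exact .zero⟩, hw⟩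

/-- The class in `H_b^2` of a closed 2-form, with respect to its own Reeb bundle. -/
def reebClass (w : DiffForm E M 2) (hw : DiffForm.d w = 0) : BasicCohomology (reebBundle w) 2 :=
  basicClass (reebBundle w) w (mem_basicCocycles_reebBundle hw)

end Forms

/-! ### Exterior products -/

section Wedge

variable {V : Type*} [AddCommGroup V] [Module ℝ V]

/-- The exterior product of alternating forms, the sum of
`sign σ * a (v (σ 0), …) * b (v (σ k), …)` over the `(k, l)`-shuffles `σ`. -/
def wedge {k l : ℕ} (a : V [⋀^Fin k]→ₗ[ℝ] ℝ) (b : V [⋀^Fin l]→ₗ[ℝ] ℝ) :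
    V [⋀^Fin (k + l)]→ₗ[ℝ] ℝ :=
  ((LinearMap.mul' ℝ ℝ).compAlternatingMap (a.domCoprod b)).domDomCongr finSumFinEquiv

/-- The `n`-th exterior power of a 2-form. -/
def wedgePow (b : V [⋀^Fin 2]→ₗ[ℝ] ℝ) : (n : ℕ) → V [⋀^Fin (2 * n)]→ₗ[ℝ] ℝ
  | 0 => AlternatingMap.constOfIsEmpty ℝ V (Fin 0) 1
  | n + 1 => wedge (wedgePow b n) b

end Wedge

section Contact

variable {n : ℕ} {M : Type*} [TopologicalSpace M]
  [ChartedSpace (EuclideanSpace ℝ (Fin (2 * n + 1))) M]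
  [IsManifold (𝓡 (2 * n + 1)) ∞ M]

/-- A presymplectic form on a manifold of dimension `2n+1`: a closed 2-form of rank `2n`. -/
structure IsPresymplectic (w : DiffForm (EuclideanSpace ℝ (Fin (2 * n + 1))) M 2) : Prop where
  closed : DiffForm.d w = 0
  rank_eq : ∀ x : M, Module.finrank ℝ (LinearMap.range (contraction w x)) = 2 * n

/-- A contact form on a manifold of dimension `2n+1`: a 1-form `l` such that the top-degree form
`l ∧ (d l)^n` vanishes nowhere. -/
def IsContact (l : DiffForm (EuclideanSpace ℝ (Fin (2 * n + 1))) M 1) : Prop :=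
  ∀ x : M, wedge (l.1 x).toAlternatingMap (wedgePow ((DiffForm.d l).1 x).toAlternatingMap n) ≠ 0

/-- A 2-form of contact type: the differential of a contact form. -/
def IsContactType (w : DiffForm (EuclideanSpace ℝ (Fin (2 * n + 1))) M 2) : Prop :=
  ∃ l : DiffForm (EuclideanSpace ℝ (Fin (2 * n + 1))) M 1, IsContact l ∧ w = DiffForm.d l

end Contact

end Presymplectic

end

open scoped Manifold ContDiff Topology

noncomputable section

/-! Suppose `dλ = da` with `a` basic for the Reeb foliation. Then `g = λ - a` is closed. The
dimension is odd, so at each point some `r ≠ 0` satisfies `ι_r dλ = 0`, and `a(r) = 0` since `a` is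
horizontal. So `r` kills the top-degree form `a ∧ (dλ)^n`, which therefore vanishes, and `g ∧ (dλ)^n
= λ ∧ (dλ)^n` is a volume form. But `g ∧ (dλ)^n = -d(g ∧ λ ∧ (dλ)^(n-1))` is exact because `dg = 0`,
and an exact form on a closed manifold cannot be a volume form (`not_forall_contactWedge_ne_zero`).

The last step is Stokes' theorem, proved here by hand. No orientation is chosen: a top-degree form
times the sign of the volume form is a density (`isDensity_signedWedge`), and densities are
integrated chart by chart (`IsDensity.setIntegral_eq`). With `n = k + 1` and a partition of unity
`ρ`, the form `g ∧ (dλ)^k ∧ dλ` is the sum of the `g ∧ (dλ)^k ∧ d(ρ_j λ)`. Each summand lives in one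
chart, where it is a combination of partial derivatives of functions with compact support
(`contactWedge_eq_sum_fderiv`) and so integrates to zero. The total is the integral of the absolute
value of a volume form, a contradiction. -/

namespace Presymplectic

/-! ### Multilinear algebra of the form `g ∧ b ^ k ∧ c`. -/

section Algebra

variable {V : Type*} [AddCommGroup V] [Module ℝ V]

/-- The tensor product of two real multilinear forms, on consecutive arguments. -/
def tensorForm {k l : ℕ} (a : MultilinearMap ℝ (fun _ : Fin k ↦ V) ℝ)
    (b : MultilinearMap ℝ (fun _ : Fin l ↦ V) ℝ) :
    MultilinearMap ℝ (fun _ : Fin (k + l) ↦ V) ℝ :=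
  ((LinearMap.mul' ℝ ℝ).compMultilinearMap (a.domCoprod b)).domDomCongr finSumFinEquiv

theorem tensorForm_apply {k l : ℕ} (a : MultilinearMap ℝ (fun _ : Fin k ↦ V) ℝ)
    (b : MultilinearMap ℝ (fun _ : Fin l ↦ V) ℝ) (v : Fin (k + l) → V) :
    tensorForm a b v = a (fun i ↦ v (Fin.castAdd l i)) * b (fun i ↦ v (Fin.natAdd k i)) := by
  simp [tensorForm]

/-- Because `wedge` sums over shuffles, no factorials appear. This turns iterated shuffle sums into
a single sum over all permutations. -/
theorem alternatization_tensorForm {k l : ℕ} (a : MultilinearMap ℝ (fun _ : Fin k ↦ V) ℝ)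
    (b : MultilinearMap ℝ (fun _ : Fin l ↦ V) ℝ) :
    MultilinearMap.alternatization (tensorForm a b) =
      wedge (MultilinearMap.alternatization a) (MultilinearMap.alternatization b) := by
  rw [wedge, ← MultilinearMap.domCoprod_alternization]
  ext v
  simp only [MultilinearMap.alternatization_apply, AlternatingMap.domDomCongr_apply,
    LinearMap.compAlternatingMap_apply, map_sum]
  rw [← Equiv.sum_comp (finSumFinEquiv (m := k) (n := l)).permCongr]
  refine Finset.sum_congr rfl fun σ _ ↦ ?_
  simp [tensorForm, Equiv.Perm.sign_permCongr, Function.comp_def, Units.smul_def, -zsmul_eq_mul]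

/-- Alternatization multiplies a form that is already alternating by `2!`; this is the origin of
every power of `1 / 2` below. -/
theorem alternatization_half (b : V [⋀^Fin 2]→ₗ[ℝ] ℝ) :
    MultilinearMap.alternatization ((1 / 2 : ℝ) • (b : MultilinearMap ℝ (fun _ : Fin 2 ↦ V) ℝ))
      = b := by
  rw [← AlternatingMap.coe_smul, AlternatingMap.coe_alternatization]
  ext v
  simp

theorem alternatization_of_subsingleton {ι : Type*} [Subsingleton ι] [Fintype ι] [DecidableEq ι]
    (b : V [⋀^ι]→ₗ[ℝ] ℝ) :
    MultilinearMap.alternatization (b : MultilinearMap ℝ (fun _ : ι ↦ V) ℝ) = b := by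
  rw [AlternatingMap.coe_alternatization]
  have : (Fintype.card ι).factorial = 1 :=
    Nat.factorial_eq_one.2 (Fintype.card_le_one_iff_subsingleton.2 inferInstance)
  rw [this, one_smul]

/-- The tensor power `b ⊗ ⋯ ⊗ b`, divided by `2 ^ n`. -/
def tensorPow (b : V [⋀^Fin 2]→ₗ[ℝ] ℝ) : (n : ℕ) → MultilinearMap ℝ (fun _ : Fin (2 * n) ↦ V) ℝ
  | 0 => (AlternatingMap.constOfIsEmpty ℝ V (Fin 0) 1).toMultilinearMap
  | n + 1 => tensorForm (tensorPow b n) ((1 / 2 : ℝ) • (b : MultilinearMap ℝ (fun _ : Fin 2 ↦ V) ℝ))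

theorem alternatization_tensorPow (b : V [⋀^Fin 2]→ₗ[ℝ] ℝ) (n : ℕ) :
    MultilinearMap.alternatization (tensorPow b n) = wedgePow b n := by
  induction n with
  | zero => exact alternatization_of_subsingleton (AlternatingMap.constOfIsEmpty ℝ V (Fin 0) 1)
  | succ n ih =>
    rw [wedgePow, ← ih, ← alternatization_half b, ← alternatization_tensorForm,
      alternatization_half b]
    rfl

theorem tensorPow_apply (b : V [⋀^Fin 2]→ₗ[ℝ] ℝ) (n : ℕ) (v : Fin (2 * n) → V) :
    tensorPow b n v = (1 / 2) ^ n *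
      ∏ i : Fin n, b ![v ⟨2 * i, by omega⟩, v ⟨2 * i + 1, by omega⟩] := by
  induction n with
  | zero => simp [tensorPow]
  | succ n ih =>
    have h : (fun i : Fin 2 ↦ v (Fin.natAdd (2 * n) i)) =
        ![v ⟨2 * n, by omega⟩, v ⟨2 * n + 1, by omega⟩] := by
      ext i
      fin_cases i <;> rfl
    have h0 : tensorPow b (n + 1) v = tensorPow b n (fun i ↦ v (Fin.castAdd 2 i)) *
        ((1 / 2 : ℝ) • (b : MultilinearMap ℝ (fun _ : Fin 2 ↦ V) ℝ))
          (fun i : Fin 2 ↦ v (Fin.natAdd (2 * n) i)) := tensorForm_apply _ _ _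
    rw [h0, ih, Fin.prod_univ_castSucc, pow_succ, h]
    simp only [smul_apply, smul_eq_mul, Fin.val_last, Fin.val_castSucc, Fin.castAdd_mk,
      AlternatingMap.coe_multilinearMap]
    ring

/-- The form `g ∧ b ^ k ∧ c`. -/
def contactWedge (g : V [⋀^Fin 1]→ₗ[ℝ] ℝ) (b c : V [⋀^Fin 2]→ₗ[ℝ] ℝ) (k : ℕ) :
    V [⋀^Fin (1 + (2 * k + 2))]→ₗ[ℝ] ℝ :=
  wedge g (wedge (wedgePow b k) c)

/-- The product of values of `g`, `b` and `c` of which `g ∧ b ^ k ∧ c` is a multiple of the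
alternatization. -/
def contactTerm (g : V [⋀^Fin 1]→ₗ[ℝ] ℝ) (b c : V [⋀^Fin 2]→ₗ[ℝ] ℝ) (k : ℕ)
    (v : Fin (1 + (2 * k + 2)) → V) : ℝ :=
  g ![v ⟨0, by omega⟩] *
    (∏ i : Fin k, b ![v ⟨2 * i + 1, by omega⟩, v ⟨2 * i + 2, by omega⟩]) *
    c ![v ⟨2 * k + 1, by omega⟩, v ⟨2 * k + 2, by omega⟩]

/-- With this explicit formula, linearity, pullback and differentiation of the wedge product can be
checked term by term. -/
theorem contactWedge_apply (g : V [⋀^Fin 1]→ₗ[ℝ] ℝ) (b c : V [⋀^Fin 2]→ₗ[ℝ] ℝ) (k : ℕ)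
    (v : Fin (1 + (2 * k + 2)) → V) :
    contactWedge g b c k v = (1 / 2) ^ (k + 1) *
      ∑ σ : Equiv.Perm (Fin (1 + (2 * k + 2))),
        (Equiv.Perm.sign σ : ℝ) * contactTerm g b c k (v ∘ σ) := by
  rw [contactWedge, ← alternatization_half c, ← alternatization_tensorPow,
    ← alternatization_of_subsingleton g, ← alternatization_tensorForm, ← alternatization_tensorForm,
    alternatization_half c, alternatization_of_subsingleton g, MultilinearMap.alternatization_apply,
    Finset.mul_sum]
  refine Finset.sum_congr rfl fun σ _ ↦ ?_
  rw [MultilinearMap.domDomCongr_apply, tensorForm_apply, tensorForm_apply, tensorPow_apply,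
    Units.smul_def, zsmul_eq_mul]
  have h1 : (fun i : Fin 1 ↦ v (σ (Fin.castAdd (2 * k + 2) i))) = ![v (σ ⟨0, by omega⟩)] := by
    ext i
    fin_cases i
    rfl
  have h2 : (fun i : Fin 2 ↦ v (σ (Fin.natAdd 1 (Fin.natAdd (2 * k) i)))) =
      ![v (σ ⟨2 * k + 1, by omega⟩), v (σ ⟨2 * k + 2, by omega⟩)] := by
    ext i
    fin_cases i
    · exact congrArg (fun j ↦ v (σ j)) (Fin.ext (by simp +arith))
    · exact congrArg (fun j ↦ v (σ j)) (Fin.ext (by simp +arith))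
  rw [h1, h2]
  have h3 : ∀ i : Fin k, b ![v (σ (Fin.natAdd 1 (Fin.castAdd 2 ⟨2 * i, by omega⟩))),
      v (σ (Fin.natAdd 1 (Fin.castAdd 2 ⟨2 * i + 1, by omega⟩)))] =
      b ![v (σ ⟨2 * i + 1, by omega⟩), v (σ ⟨2 * i + 2, by omega⟩)] := by
    intro i
    have e1 : Fin.natAdd 1 (Fin.castAdd 2 (⟨2 * i, by omega⟩ : Fin (2 * k))) =
        ⟨2 * i + 1, by omega⟩ := Fin.ext (by simp; omega)
    have e2 : Fin.natAdd 1 (Fin.castAdd 2 (⟨2 * i + 1, by omega⟩ : Fin (2 * k))) =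
        ⟨2 * i + 2, by omega⟩ := Fin.ext (by simp; omega)
    rw [e1, e2]
  simp only [h3, contactTerm, Function.comp_apply, pow_succ, smul_apply, smul_eq_mul,
    AlternatingMap.coe_multilinearMap]
  ring

theorem contactWedge_compLinearMap {W : Type*} [AddCommGroup W] [Module ℝ W]
    (g : V [⋀^Fin 1]→ₗ[ℝ] ℝ) (b c : V [⋀^Fin 2]→ₗ[ℝ] ℝ) (k : ℕ) (f : W →ₗ[ℝ] V)
    (v : Fin (1 + (2 * k + 2)) → W) :
    contactWedge (g.compLinearMap f) (b.compLinearMap f) (c.compLinearMap f) k v =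
      contactWedge g b c k (f ∘ v) := by
  have h1 : ∀ x : W, (fun i ↦ f (![x] i)) = ![f x] := fun x ↦ by ext i; fin_cases i; rfl
  have h2 : ∀ x y : W, (fun i ↦ f (![x, y] i)) = ![f x, f y] := fun x y ↦ by ext i; fin_cases i <;> rfl
  simp only [contactWedge_apply, contactTerm, AlternatingMap.compLinearMap_apply, h1, h2,
    Function.comp_apply]

theorem contactWedge_add (g : V [⋀^Fin 1]→ₗ[ℝ] ℝ) (b c d : V [⋀^Fin 2]→ₗ[ℝ] ℝ) (k : ℕ)
    (v : Fin (1 + (2 * k + 2)) → V) :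
    contactWedge g b (c + d) k v = contactWedge g b c k v + contactWedge g b d k v := by
  simp only [contactWedge_apply, contactTerm, AlternatingMap.add_apply]
  rw [← mul_add, ← Finset.sum_add_distrib]
  congr 1
  exact Finset.sum_congr rfl fun σ _ ↦ by ring

theorem contactWedge_zero (g : V [⋀^Fin 1]→ₗ[ℝ] ℝ)
    (b : V [⋀^Fin 2]→ₗ[ℝ] ℝ) (k : ℕ) (v : Fin (1 + (2 * k + 2)) → V) :
    contactWedge g b 0 k v = 0 := by
  simp [contactWedge_apply, contactTerm]

theorem contactWedge_sub (g h : V [⋀^Fin 1]→ₗ[ℝ] ℝ) (b c : V [⋀^Fin 2]→ₗ[ℝ] ℝ) (k : ℕ)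
    (v : Fin (1 + (2 * k + 2)) → V) :
    contactWedge (g - h) b c k v = contactWedge g b c k v - contactWedge h b c k v := by
  simp only [contactWedge_apply, contactTerm, AlternatingMap.sub_apply]
  rw [← mul_sub, ← Finset.sum_sub_distrib]
  congr 1
  exact Finset.sum_congr rfl fun σ _ ↦ by ring

/-- A sum over permutations of terms that do not see a transposition, weighted with the signs,
vanishes. -/
theorem sum_sign_mul_eq_zero {m : ℕ} (f : Equiv.Perm (Fin m) → ℝ) {i j : Fin m} (hij : i ≠ j)
    (hf : ∀ σ, f (σ * Equiv.swap i j) = f σ) :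
    ∑ σ : Equiv.Perm (Fin m), (Equiv.Perm.sign σ : ℝ) * f σ = 0 := by
  -- Reindexing by `σ ↦ σ * swap i j` keeps `f` and reverses the sign, so the sum equals its own
  -- negative.
  have h := Equiv.sum_comp (Equiv.mulRight (Equiv.swap i j))
    fun σ : Equiv.Perm (Fin m) ↦ (Equiv.Perm.sign σ : ℝ) * f σ
  simp only [Equiv.coe_mulRight, hf, Equiv.Perm.sign_mul, Equiv.Perm.sign_swap hij] at h
  simp at h
  linarith

/-- An alternating 2-form on a space of odd dimension is degenerate. -/
theorem exists_ne_zero_forall_eq_zero {m : ℕ} (hm : Odd m) (e : Module.Basis (Fin m) ℝ V)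
    (b : V [⋀^Fin 2]→ₗ[ℝ] ℝ) : ∃ r : V, r ≠ 0 ∧ ∀ v, b ![r, v] = 0 := by
  have swap : ∀ v w, b ![v, w] = -b ![w, v] := by
    intro v w
    have h := b.map_swap ![w, v] (i := 0) (j := 1) (by decide)
    have h2 : (![w, v] ∘ Equiv.swap 0 1 : Fin 2 → V) = ![v, w] := by
      ext i; fin_cases i <;> rfl
    rwa [h2] at h
  let l (w : V) : V →ₗ[ℝ] ℝ :=
    { toFun := fun v ↦ b ![v, w]
      map_add' := fun x y ↦ b.map_vecCons_add ![w] x y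
      map_smul' := fun c x ↦ b.map_vecCons_smul ![w] c x }
  let A : Matrix (Fin m) (Fin m) ℝ := Matrix.of fun i j ↦ b ![e i, e j]
  -- The Gram matrix is skew-symmetric of odd size `m`, so `det A = det Aᵀ = (-1)^m det A = -det A`.
  have hA : A.det = 0 := by
    have h1 : A.transpose = -A := by
      ext i j
      exact swap _ _
    have h2 := congrArg Matrix.det h1
    rw [Matrix.det_transpose, Matrix.det_neg, Fintype.card_fin, hm.neg_one_pow] at h2
    linarith
  obtain ⟨a, ha, hAa⟩ := Matrix.exists_vecMul_eq_zero_iff.2 hA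
  refine ⟨∑ i, a i • e i, fun h ↦ ha ?_, fun v ↦ ?_⟩
  · ext i
    have := Fintype.linearIndependent_iff.1 e.linearIndependent a h i
    simpa using this
  · rw [swap, neg_eq_zero]
    suffices H : l (∑ i, a i • e i) = 0 from LinearMap.congr_fun H v
    refine e.ext fun j ↦ ?_
    change b ![e j, _] = 0
    rw [swap, neg_eq_zero]
    change l (e j) _ = 0
    rw [map_sum]
    simp only [map_smul, smul_eq_mul]
    exact congrFun hAa j

/-- A top-degree alternating form which is killed by a non-zero vector vanishes. -/
theorem alternatingMap_eq_zero_of_contraction {ι : Type*} [Fintype ι] [DecidableEq ι]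
    (e : Module.Basis ι ℝ V) (w : V [⋀^ι]→ₗ[ℝ] ℝ) {r : V} (hr : r ≠ 0)
    (h : ∀ v : ι → V, ∀ i, v i = r → w v = 0) : w = 0 := by
  rw [← AlternatingMap.map_basis_eq_zero_iff e]
  obtain ⟨i, hi⟩ : ∃ i, e.repr r i ≠ 0 := by
    by_contra! h0
    exact hr (e.repr.map_eq_zero_iff.1 (Finsupp.ext h0))
  -- Replacing `e i` by `r` multiplies `w e` by the `i`-th coordinate of `r`, chosen non-zero; the
  -- result is zero by hypothesis.
  have h1 := h (Function.update e i r) i (by simp)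
  rw [← e.sum_repr r, AlternatingMap.map_update_sum] at h1
  rw [Finset.sum_eq_single i] at h1
  · simpa [hi] using h1
  · intro j _ hj
    rw [AlternatingMap.map_update_smul, AlternatingMap.map_update_self _ _ hj.symm, smul_zero]
  · simp

/-- In each term of the permutation sum, the argument `r` lands in a slot of `g`, of one of the
factors `b`, or of `c`, and kills that factor. A top-degree form killed by a non-zero vector
vanishes. -/
theorem contactWedge_eq_zero {k : ℕ} (e : Module.Basis (Fin (1 + (2 * k + 2))) ℝ V)
    (g : V [⋀^Fin 1]→ₗ[ℝ] ℝ) (b c : V [⋀^Fin 2]→ₗ[ℝ] ℝ) {r : V} (hr : r ≠ 0)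
    (hg : g ![r] = 0) (hb : ∀ v, b ![r, v] = 0) (hc : ∀ v, c ![r, v] = 0) :
    contactWedge g b c k = 0 := by
  refine alternatingMap_eq_zero_of_contraction e _ hr fun v i hi ↦ ?_
  have swap : ∀ b : V [⋀^Fin 2]→ₗ[ℝ] ℝ, (∀ v, b ![r, v] = 0) → ∀ v, b ![v, r] = 0 := by
    intro b hb v
    have h := b.map_swap ![r, v] (i := 0) (j := 1) (by decide)
    have h2 : (![r, v] ∘ Equiv.swap 0 1 : Fin 2 → V) = ![v, r] := by
      ext i; fin_cases i <;> rfl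
    rw [h2, hb, neg_zero] at h
    exact h
  rw [contactWedge_apply, Finset.sum_eq_zero, mul_zero]
  intro σ _
  obtain ⟨j, rfl⟩ := σ.surjective i
  suffices H : contactTerm g b c k (v ∘ σ) = 0 by rw [H, mul_zero]
  have hj : (v ∘ σ) j = r := hi
  generalize v ∘ σ = u at hj
  unfold contactTerm
  obtain ⟨j, hjk⟩ := j
  rcases Nat.lt_or_ge j 1 with h0 | h0
  · obtain rfl : j = 0 := by omega
    rw [hj, hg]; simp
  rcases Nat.lt_or_ge j (2 * k + 1) with h1 | h1
  · have hk : (j - 1) / 2 < k := by omega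
    rw [Finset.prod_eq_zero (Finset.mem_univ (⟨(j - 1) / 2, hk⟩ : Fin k))]
    · simp
    rcases Nat.even_or_odd' (j - 1) with ⟨a, ha | ha⟩
    · have : (⟨2 * ((j - 1) / 2) + 1, by omega⟩ : Fin (1 + (2 * k + 2))) = ⟨j, hjk⟩ :=
        Fin.ext (by simp; omega)
      simp only [this, hj, hb]
    · have : (⟨2 * ((j - 1) / 2) + 2, by omega⟩ : Fin (1 + (2 * k + 2))) = ⟨j, hjk⟩ :=
        Fin.ext (by simp; omega)
      simp only [this, hj, swap b hb]
  · rcases Nat.lt_or_ge j (2 * k + 2) with h2 | h2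
    · obtain rfl : j = 2 * k + 1 := by omega
      rw [hj, hc]; simp
    · obtain rfl : j = 2 * k + 2 := by omega
      rw [hj, swap c hc]; simp

end Algebra

/-! ### Densities and the change of charts. -/

section Densities

open MeasureTheory

variable {E : Type*} [NormedAddCommGroup E] [NormedSpace ℝ E]
  {M : Type*} [TopologicalSpace M] [ChartedSpace E M]

variable (E M) in
/-- A density on `M`: functions on the targets of the charts which transform with the absolute value
of the determinant of the change of charts. -/
def IsDensity (h : M → E → ℝ) : Prop :=
  ∀ p q : M, ∀ y ∈ (chartAt E p).target, (chartAt E p).symm y ∈ (chartAt E q).source →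
    h p y = |(fderiv ℝ (chartAt E q ∘ (chartAt E p).symm) y).det| *
      h q ((chartAt E q ∘ (chartAt E p).symm) y)

theorem IsDensity.mul {h : M → E → ℝ} (hh : IsDensity E M h) (f : M → ℝ) :
    IsDensity E M fun p y ↦ f ((chartAt E p).symm y) * h p y := by
  intro p q y hy hq
  simp only [Function.comp_apply, (chartAt E q).left_inv hq]
  rw [hh p q y hy hq]
  simp only [Function.comp_apply]
  ring

variable [FiniteDimensional ℝ E] [MeasurableSpace E] [BorelSpace E] [IsManifold 𝓘(ℝ, E) ∞ M]
  (μ : Measure E) [μ.IsAddHaarMeasure]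

/-- The integral of a density supported in the intersection of the domains of two charts can be
computed in either chart. -/
theorem IsDensity.setIntegral_eq {h : M → E → ℝ} (hh : IsDensity E M h) (p q : M)
    (hp : ∀ y ∈ (chartAt E p).target, (chartAt E p).symm y ∉ (chartAt E q).source → h p y = 0)
    (hq : ∀ y ∈ (chartAt E q).target, (chartAt E q).symm y ∉ (chartAt E p).source → h q y = 0) :
    ∫ y in (chartAt E p).target, h p y ∂μ = ∫ y in (chartAt E q).target, h q y ∂μ := by
  have key : ∀ p q : M, IsOpen ((chartAt E p).target ∩ (chartAt E p).symm ⁻¹' (chartAt E q).source) :=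
    fun p q ↦ (chartAt E p).isOpen_inter_preimage_symm (chartAt E q).open_source
  have red : ∀ p q : M,
      (∀ y ∈ (chartAt E p).target, (chartAt E p).symm y ∉ (chartAt E q).source → h p y = 0) →
      ∫ y in (chartAt E p).target, h p y ∂μ =
        ∫ y in (chartAt E p).target ∩ (chartAt E p).symm ⁻¹' (chartAt E q).source, h p y ∂μ :=
    fun p q hp ↦ setIntegral_eq_of_subset_of_forall_sdiff_eq_zero
      (chartAt E p).open_target.measurableSet Set.inter_subset_left
      fun y hy ↦ hp y hy.1 fun h ↦ hy.2 ⟨hy.1, h⟩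
  rw [red p q hp, red q p hq]
  set T := chartAt E q ∘ (chartAt E p).symm with hT
  -- The overlap seen in chart `q` is the image under the transition map `T` of the overlap seen in
  -- chart `p`, so the change of variables formula applies.
  have himg : (chartAt E q).target ∩ (chartAt E q).symm ⁻¹' (chartAt E p).source =
      T '' ((chartAt E p).target ∩ (chartAt E p).symm ⁻¹' (chartAt E q).source) := by
    ext z
    constructor
    · rintro ⟨hz, hz'⟩
      refine ⟨chartAt E p ((chartAt E q).symm z), ⟨(chartAt E p).map_source hz', ?_⟩, ?_⟩
      · simp only [Set.mem_preimage, (chartAt E p).left_inv hz']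
        exact (chartAt E q).map_target hz
      · simp only [hT, Function.comp_apply, (chartAt E p).left_inv hz', (chartAt E q).right_inv hz]
    · rintro ⟨y, ⟨hy, hy'⟩, rfl⟩
      refine ⟨(chartAt E q).map_source hy', ?_⟩
      simp only [hT, Set.mem_preimage, Function.comp_apply, (chartAt E q).left_inv hy']
      exact (chartAt E p).map_target hy
  rw [himg, integral_image_eq_integral_abs_det_fderiv_smul μ (key p q).measurableSet
    (f' := fderiv ℝ T)]
  · exact setIntegral_congr_fun (key p q).measurableSet fun y hy ↦ hh p q y hy.1 hy.2
  · exact fun y hy ↦ (((transition_contDiffAt p q hy.1 hy.2).differentiableAt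
      (by simp)).hasFDerivAt).hasFDerivWithinAt
  · intro y hy z hz hyz
    have h1 : (chartAt E p).symm y = (chartAt E p).symm z :=
      (chartAt E q).injOn hy.2 hz.2 hyz
    exact (chartAt E p).symm.injOn hy.1 hz.1 h1

end Densities

/-! ### Integrals of derivatives of functions with compact support. -/

section Euclidean

open MeasureTheory

variable {E : Type*} [NormedAddCommGroup E] [NormedSpace ℝ E] [FiniteDimensional ℝ E]
  [MeasurableSpace E] [BorelSpace E] (μ : Measure E) [μ.IsAddHaarMeasure]

/-- Integration by parts against the constant function `1`. -/
theorem integral_fderiv_eq_zero {f : E → ℝ} (hf : ContDiff ℝ 1 f) (hc : HasCompactSupport f)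
    (v : E) : ∫ y, fderiv ℝ f y v ∂μ = 0 := by
  have hint : Integrable (fun y ↦ fderiv ℝ f y v) μ :=
    ((hf.continuous_fderiv one_ne_zero).clm_apply continuous_const).integrable_of_hasCompactSupport
      (hc.fderiv_apply ℝ v)
  have h := integral_mul_fderiv_eq_neg_fderiv_mul_of_integrable (μ := μ) (f := fun _ : E ↦ (1 : ℝ))
    (g := f) (v := v) (by simp) (by simpa using hint)
    (by simpa using hf.continuous.integrable_of_hasCompactSupport hc)
    (fun _ _ ↦ by fun_prop) (fun _ _ ↦ (hf.differentiable one_ne_zero).differentiableAt)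
  simpa using h

/-- Partial derivatives of functions with compact support in an open set integrate to zero, also
against a locally constant factor. -/
theorem setIntegral_locallyConstant_mul_fderiv {U K : Set E} (hU : IsOpen U) (hK : IsCompact K)
    (hKU : K ⊆ U) {s u : E → ℝ} (hs : ∀ y ∈ U, ∀ᶠ z in 𝓝 y, s z = s y) (hu : ContDiffOn ℝ 1 u U)
    (huK : ∀ y ∈ U, y ∉ K → u y = 0) (v : E) :
    IntegrableOn (fun y ↦ s y * fderiv ℝ u y v) U μ ∧
      ∫ y in U, s y * fderiv ℝ u y v ∂μ = 0 := by
  -- Extension of `s * u` by zero. It is `C^1` on `U` because `s` is locally constant there, and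
  -- near any point outside `U` it vanishes, since `K` is closed and contained in `U`.
  set F : E → ℝ := U.indicator fun y ↦ s y * u y with hF
  have hFK : ∀ y, y ∉ K → F y = 0 := by
    intro y hy
    by_cases h : y ∈ U
    · simp [hF, h, huK y h hy]
    · simp [hF, h]
  have hev : ∀ y ∈ U, F =ᶠ[𝓝 y] fun z ↦ s y * u z := by
    intro y hy
    filter_upwards [hU.mem_nhds hy, hs y hy] with z hz hz'
    simp [hF, hz, hz']
  have hFs : ContDiff ℝ 1 F := by
    rw [contDiff_iff_contDiffAt]
    intro y
    by_cases hy : y ∈ U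
    · exact (contDiffAt_const.mul (hu.contDiffAt (hU.mem_nhds hy))).congr_of_eventuallyEq (hev y hy)
    · have h0 : F =ᶠ[𝓝 y] fun _ ↦ 0 := by
        filter_upwards [hK.isClosed.isOpen_compl.mem_nhds fun h ↦ hy (hKU h)] with z hz
        exact hFK z hz
      exact contDiffAt_const.congr_of_eventuallyEq h0
  have hFc : HasCompactSupport F := HasCompactSupport.intro hK fun y hy ↦ hFK y hy
  have hd : Set.EqOn (fun y ↦ fderiv ℝ F y v) (fun y ↦ s y * fderiv ℝ u y v) U := by
    intro y hy
    have h1 : HasFDerivAt (fun z ↦ s y * u z) (s y • fderiv ℝ u y) y :=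
      ((hu.contDiffAt (hU.mem_nhds hy)).differentiableAt one_ne_zero).hasFDerivAt.const_mul _
    simp only [(hev y hy).fderiv_eq, h1.fderiv]
    rfl
  have hint : Integrable (fun y ↦ fderiv ℝ F y v) μ :=
    ((hFs.continuous_fderiv one_ne_zero).clm_apply continuous_const).integrable_of_hasCompactSupport
      (hFc.fderiv_apply ℝ v)
  refine ⟨hint.integrableOn.congr_fun hd hU.measurableSet, ?_⟩
  rw [← setIntegral_congr_fun hU.measurableSet hd, setIntegral_eq_integral_of_forall_compl_eq_zero,
    integral_fderiv_eq_zero μ hFs hFc]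
  intro y hy
  have h0 : F =ᶠ[𝓝 y] fun _ ↦ 0 := by
    filter_upwards [hK.isClosed.isOpen_compl.mem_nhds fun h ↦ hy (hKU h)] with z hz
    exact hFK z hz
  rw [h0.fderiv_eq]
  simp

end Euclidean

/-! ### The form `g ∧ (dl)^k ∧ dm` as a divergence. -/

section Divergence

open MeasureTheory

variable {E : Type*} [NormedAddCommGroup E] [NormedSpace ℝ E]

theorem extDeriv_apply_pair {m : E → E [⋀^Fin 1]→L[ℝ] ℝ} {y : E} (hm : DifferentiableAt ℝ m y)
    (a b : E) : extDeriv m y ![a, b] =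
      fderiv ℝ (fun z ↦ m z ![b]) y a - fderiv ℝ (fun z ↦ m z ![a]) y b := by
  rw [extDeriv_apply hm, Fin.sum_univ_two]
  have h0 : (0 : Fin 2).removeNth ![a, b] = ![b] := by ext i; fin_cases i; rfl
  have h1 : (1 : Fin 2).removeNth ![a, b] = ![a] := by ext i; fin_cases i; rfl
  rw [h0, h1]
  simp [sub_eq_add_neg]

theorem contDiffOn_apply_const {k : ℕ} {n : WithTop ℕ∞} {m : E → E [⋀^Fin k]→L[ℝ] ℝ} {U : Set E}
    (hm : ContDiffOn ℝ n m U) (v : Fin k → E) : ContDiffOn ℝ n (fun y ↦ m y v) U :=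
  (ContinuousAlternatingMap.apply ℝ E ℝ v).contDiff.comp_contDiffOn hm

theorem contDiffOn_extDeriv {k : ℕ} {m : E → E [⋀^Fin k]→L[ℝ] ℝ} {U : Set E} (hU : IsOpen U)
    (hm : ContDiffOn ℝ ∞ m U) : ContDiffOn ℝ ∞ (extDeriv m) U :=
  ContDiff.comp_contDiffOn (g := ContinuousAlternatingMap.alternatizeUncurryFinCLM ℝ E ℝ)
    (ContinuousLinearMap.contDiff _) (hm.fderiv_of_isOpen hU (by simp))

/-- The components of a primitive of `g ∧ (d l) ^ k ∧ d m`, for `g` closed. -/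
def contactPrimitive (g l m : E → E [⋀^Fin 1]→L[ℝ] ℝ) (k : ℕ) (v : Fin (1 + (2 * k + 2)) → E)
    (y : E) : ℝ :=
  g y ![v ⟨0, by omega⟩] *
    (∏ i : Fin k, extDeriv l y ![v ⟨2 * i + 1, by omega⟩, v ⟨2 * i + 2, by omega⟩]) *
    m y ![v ⟨2 * k + 2, by omega⟩]

variable {U : Set E} {g l m : E → E [⋀^Fin 1]→L[ℝ] ℝ}

theorem contDiffOn_contactPrimitive (hU : IsOpen U) (hg : ContDiffOn ℝ ∞ g U)
    (hl : ContDiffOn ℝ ∞ l U) (hm : ContDiffOn ℝ ∞ m U) (k : ℕ) (v : Fin (1 + (2 * k + 2)) → E) :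
    ContDiffOn ℝ ∞ (contactPrimitive g l m k v) U :=
  ((contDiffOn_apply_const hg _).mul
    (contDiffOn_prod fun _ _ ↦ contDiffOn_apply_const (contDiffOn_extDeriv hU hl) _)).mul
    (contDiffOn_apply_const hm _)

/-- Product rule, grouped by whether the derivative falls on `g`, on one of the factors `dl`, or on
`m`: the three groups have different fates after alternation. -/
theorem fderiv_contactPrimitive (hU : IsOpen U) (hg : ContDiffOn ℝ ∞ g U)
    (hl : ContDiffOn ℝ ∞ l U) (hm : ContDiffOn ℝ ∞ m U) (k : ℕ) (v : Fin (1 + (2 * k + 2)) → E)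
    {y : E} (hy : y ∈ U) (w : E) :
    fderiv ℝ (contactPrimitive g l m k v) y w =
      fderiv ℝ (fun z ↦ g z ![v ⟨0, by omega⟩]) y w *
        (∏ i : Fin k, extDeriv l y ![v ⟨2 * i + 1, by omega⟩, v ⟨2 * i + 2, by omega⟩]) *
        m y ![v ⟨2 * k + 2, by omega⟩] +
      (∑ i : Fin k, g y ![v ⟨0, by omega⟩] *
        ((∏ j ∈ Finset.univ.erase i,
            extDeriv l y ![v ⟨2 * j + 1, by omega⟩, v ⟨2 * j + 2, by omega⟩]) *
          fderiv ℝ (fun z ↦ extDeriv l z ![v ⟨2 * i + 1, by omega⟩, v ⟨2 * i + 2, by omega⟩]) y w) *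
        m y ![v ⟨2 * k + 2, by omega⟩]) +
      g y ![v ⟨0, by omega⟩] *
        (∏ i : Fin k, extDeriv l y ![v ⟨2 * i + 1, by omega⟩, v ⟨2 * i + 2, by omega⟩]) *
        fderiv ℝ (fun z ↦ m z ![v ⟨2 * k + 2, by omega⟩]) y w := by
  have D : ∀ {n : ℕ} {a : E → E [⋀^Fin n]→L[ℝ] ℝ}, ContDiffOn ℝ ∞ a U → ∀ v,
      HasFDerivAt (fun z ↦ a z v) (fderiv ℝ (fun z ↦ a z v) y) y := fun ha v ↦
    (((contDiffOn_apply_const ha v).contDiffAt (hU.mem_nhds hy)).differentiableAt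
      (by simp)).hasFDerivAt
  have h := ((D hg ![v ⟨0, by omega⟩]).mul (HasFDerivAt.finsetProd (u := Finset.univ)
    fun (i : Fin k) _ ↦ D (contDiffOn_extDeriv hU hl)
      ![v ⟨2 * i + 1, by omega⟩, v ⟨2 * i + 2, by omega⟩])).mul (D hm ![v ⟨2 * k + 2, by omega⟩])
  have h' : fderiv ℝ (contactPrimitive g l m k v) y = _ := h.fderiv
  rw [h']
  simp only [add_apply, smul_apply, sum_apply, smul_eq_mul, Pi.mul_apply]
  rw [← Finset.sum_mul, ← Finset.mul_sum]
  ring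

theorem fderiv_extDeriv_apply_pair (hU : IsOpen U) (hl : ContDiffOn ℝ ∞ l U) {y : E} (hy : y ∈ U)
    (a b w : E) : fderiv ℝ (fun z ↦ extDeriv l z ![a, b]) y w =
      fderiv ℝ (fderiv ℝ fun z ↦ l z ![b]) y w a - fderiv ℝ (fderiv ℝ fun z ↦ l z ![a]) y w b := by
  have hev : (fun z ↦ extDeriv l z ![a, b]) =ᶠ[𝓝 y]
      fun z ↦ fderiv ℝ (fun z ↦ l z ![b]) z a - fderiv ℝ (fun z ↦ l z ![a]) z b := by
    filter_upwards [hU.mem_nhds hy] with z hz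
    exact extDeriv_apply_pair ((hl.contDiffAt (hU.mem_nhds hz)).differentiableAt (by simp)) a b
  have D : ∀ b : E, HasFDerivAt (fderiv ℝ fun z ↦ l z ![b])
      (fderiv ℝ (fderiv ℝ fun z ↦ l z ![b]) y) y := fun b ↦
    ((((contDiffOn_apply_const hl ![b]).fderiv_of_isOpen (m := ∞) hU (by simp)).contDiffAt
      (hU.mem_nhds hy)).differentiableAt (by simp)).hasFDerivAt
  have h := ((D b).clm_apply (hasFDerivAt_const a y)).sub ((D a).clm_apply (hasFDerivAt_const b y))
  rw [hev.fderiv_eq]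
  have h' := h.fderiv
  simp only [Pi.sub_def] at h'
  rw [h']
  simp

theorem fderiv_fderiv_comm (hU : IsOpen U) (hl : ContDiffOn ℝ ∞ l U) {y : E} (hy : y ∈ U)
    (a b w : E) : fderiv ℝ (fderiv ℝ fun z ↦ l z ![b]) y w a =
      fderiv ℝ (fderiv ℝ fun z ↦ l z ![b]) y a w :=
  (((contDiffOn_apply_const hl ![b]).contDiffAt (hU.mem_nhds hy)).isSymmSndFDerivAt
    two_le_infty).eq w a

/-- Slot `2 * k + 1`, which `contactPrimitive` skips, supplies the direction of differentiation.
After alternation, the terms differentiating `g` cancel since `dg = 0`, and those differentiating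
`dl` cancel since second derivatives are symmetric. Only derivatives of `m` survive. The two terms
of `dm` contribute equally, hence the factor `2`. -/
theorem contactWedge_eq_sum_fderiv (hU : IsOpen U) (hg : ContDiffOn ℝ ∞ g U)
    (hl : ContDiffOn ℝ ∞ l U) (hm : ContDiffOn ℝ ∞ m U) (hdg : ∀ y ∈ U, extDeriv g y = 0) (k : ℕ)
    (e : Fin (1 + (2 * k + 2)) → E) {y : E} (hy : y ∈ U) :
    contactWedge (g y).toAlternatingMap (extDeriv l y).toAlternatingMap
      (extDeriv m y).toAlternatingMap k e =
      2 * (1 / 2) ^ (k + 1) * ∑ σ : Equiv.Perm (Fin (1 + (2 * k + 2))), (Equiv.Perm.sign σ : ℝ) *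
        fderiv ℝ (contactPrimitive g l m k (e ∘ σ)) y (e (σ ⟨2 * k + 1, by omega⟩)) := by
  have hd : ∀ {a : E → E [⋀^Fin 1]→L[ℝ] ℝ}, ContDiffOn ℝ ∞ a U → DifferentiableAt ℝ a y :=
    fun ha ↦ (ha.contDiffAt (hU.mem_nhds hy)).differentiableAt (by simp)
  have hg_symm : ∀ a b, fderiv ℝ (fun z ↦ g z ![b]) y a = fderiv ℝ (fun z ↦ g z ![a]) y b := by
    intro a b
    have h := extDeriv_apply_pair (hd hg) a b
    rw [hdg y hy] at h
    have h0 : (0 : E [⋀^Fin 2]→L[ℝ] ℝ) ![a, b] = 0 := rfl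
    linarith
  -- Right multiplication by a transposition exchanges two slots of `e ∘ σ` and fixes the others.
  have fix : ∀ {i j x : Fin (1 + (2 * k + 2))} (σ : Equiv.Perm (Fin (1 + (2 * k + 2)))),
      x.1 ≠ i.1 → x.1 ≠ j.1 → (σ * Equiv.swap i j) x = σ x := fun σ hi hj ↦ by
    rw [Equiv.Perm.mul_apply,
      Equiv.swap_apply_of_ne_of_ne (Fin.ne_of_val_ne hi) (Fin.ne_of_val_ne hj)]
  have left : ∀ (i j : Fin (1 + (2 * k + 2))) (σ : Equiv.Perm (Fin (1 + (2 * k + 2)))),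
      (σ * Equiv.swap i j) i = σ j := fun i j σ ↦ by simp
  have right : ∀ (i j : Fin (1 + (2 * k + 2))) (σ : Equiv.Perm (Fin (1 + (2 * k + 2)))),
      (σ * Equiv.swap i j) j = σ i := fun i j σ ↦ by simp
  -- `dg = 0` makes the derivative of `g` symmetric in slots `0` and `2 * k + 1`.
  have h1 : ∑ σ : Equiv.Perm (Fin (1 + (2 * k + 2))), (Equiv.Perm.sign σ : ℝ) *
      (fderiv ℝ (fun z ↦ g z ![e (σ ⟨0, by omega⟩)]) y (e (σ ⟨2 * k + 1, by omega⟩)) *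
        (∏ i : Fin k, extDeriv l y ![e (σ ⟨2 * i + 1, by omega⟩), e (σ ⟨2 * i + 2, by omega⟩)]) *
        m y ![e (σ ⟨2 * k + 2, by omega⟩)]) = 0 := by
    refine sum_sign_mul_eq_zero _ (i := ⟨0, by omega⟩) (j := ⟨2 * k + 1, by omega⟩)
      (Fin.ne_of_val_ne (by dsimp only; omega)) fun σ ↦ ?_
    rw [left, right, hg_symm, fix σ (x := ⟨2 * k + 2, _⟩) (by dsimp only; omega) (by dsimp only; omega)]
    congr 2
    refine Finset.prod_congr rfl fun i _ ↦ ?_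
    rw [fix σ (by dsimp only; omega) (by dsimp only; omega),
      fix σ (by dsimp only; omega) (by dsimp only; omega)]
  -- The derivative of each factor `dl` is a difference of two second derivatives, symmetric in
  -- slots `2 * i + 1`, `2 * k + 1` and in slots `2 * i + 2`, `2 * k + 1` respectively.
  have h2 : ∑ σ : Equiv.Perm (Fin (1 + (2 * k + 2))), (Equiv.Perm.sign σ : ℝ) *
      (∑ i : Fin k, g y ![e (σ ⟨0, by omega⟩)] * ((∏ j ∈ Finset.univ.erase i,
          extDeriv l y ![e (σ ⟨2 * j + 1, by omega⟩), e (σ ⟨2 * j + 2, by omega⟩)]) *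
        fderiv ℝ (fun z ↦
          extDeriv l z ![e (σ ⟨2 * i + 1, by omega⟩), e (σ ⟨2 * i + 2, by omega⟩)]) y
            (e (σ ⟨2 * k + 1, by omega⟩))) *
        m y ![e (σ ⟨2 * k + 2, by omega⟩)]) = 0 := by
    simp only [fderiv_extDeriv_apply_pair hU hl hy, Finset.mul_sum]
    rw [Finset.sum_comm]
    refine Finset.sum_eq_zero fun i _ ↦ ?_
    have inv : ∀ (σ : Equiv.Perm (Fin (1 + (2 * k + 2)))) (a : Fin (1 + (2 * k + 2))),
        (a.1 = 2 * i + 1 ∨ a.1 = 2 * i + 2) →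
        (∏ j ∈ Finset.univ.erase i, extDeriv l y
          ![e ((σ * Equiv.swap a ⟨2 * k + 1, by omega⟩) ⟨2 * j + 1, by omega⟩),
            e ((σ * Equiv.swap a ⟨2 * k + 1, by omega⟩) ⟨2 * j + 2, by omega⟩)]) =
        ∏ j ∈ Finset.univ.erase i, extDeriv l y
          ![e (σ ⟨2 * j + 1, by omega⟩), e (σ ⟨2 * j + 2, by omega⟩)] := by
      intro σ a ha
      refine Finset.prod_congr rfl fun j hj ↦ ?_
      have hji : j.1 ≠ i.1 := fun h ↦ Finset.ne_of_mem_erase hj (Fin.ext h)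
      rw [fix σ (by dsimp only; omega) (by dsimp only; omega),
        fix σ (by dsimp only; omega) (by dsimp only; omega)]
    have ha := sum_sign_mul_eq_zero (fun σ : Equiv.Perm (Fin (1 + (2 * k + 2))) ↦
      g y ![e (σ ⟨0, by omega⟩)] * ((∏ j ∈ Finset.univ.erase i,
          extDeriv l y ![e (σ ⟨2 * j + 1, by omega⟩), e (σ ⟨2 * j + 2, by omega⟩)]) *
        fderiv ℝ (fderiv ℝ fun z ↦ l z ![e (σ ⟨2 * i + 2, by omega⟩)]) y
          (e (σ ⟨2 * k + 1, by omega⟩)) (e (σ ⟨2 * i + 1, by omega⟩))) *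
        m y ![e (σ ⟨2 * k + 2, by omega⟩)]) (i := ⟨2 * i + 1, by omega⟩)
        (j := ⟨2 * k + 1, by omega⟩) (Fin.ne_of_val_ne (by dsimp only; omega)) fun σ ↦ by
      rw [left, right, inv σ _ (Or.inl rfl), fderiv_fderiv_comm hU hl hy,
        fix σ (x := ⟨0, _⟩) (by dsimp only; omega) (by dsimp only; omega),
        fix σ (x := ⟨2 * k + 2, _⟩) (by dsimp only; omega) (by dsimp only; omega),
        fix σ (x := ⟨2 * i + 2, _⟩) (by dsimp only; omega) (by dsimp only; omega)]
    have hb := sum_sign_mul_eq_zero (fun σ : Equiv.Perm (Fin (1 + (2 * k + 2))) ↦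
      g y ![e (σ ⟨0, by omega⟩)] * ((∏ j ∈ Finset.univ.erase i,
          extDeriv l y ![e (σ ⟨2 * j + 1, by omega⟩), e (σ ⟨2 * j + 2, by omega⟩)]) *
        fderiv ℝ (fderiv ℝ fun z ↦ l z ![e (σ ⟨2 * i + 1, by omega⟩)]) y
          (e (σ ⟨2 * k + 1, by omega⟩)) (e (σ ⟨2 * i + 2, by omega⟩))) *
        m y ![e (σ ⟨2 * k + 2, by omega⟩)]) (i := ⟨2 * i + 2, by omega⟩)
        (j := ⟨2 * k + 1, by omega⟩) (Fin.ne_of_val_ne (by dsimp only; omega)) fun σ ↦ by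
      rw [left, right, inv σ _ (Or.inr rfl), fderiv_fderiv_comm hU hl hy,
        fix σ (x := ⟨0, _⟩) (by dsimp only; omega) (by dsimp only; omega),
        fix σ (x := ⟨2 * k + 2, _⟩) (by dsimp only; omega) (by dsimp only; omega),
        fix σ (x := ⟨2 * i + 1, _⟩) (by dsimp only; omega) (by dsimp only; omega)]
    rw [← sub_eq_zero.2 (ha.trans hb.symm), ← Finset.sum_sub_distrib]
    exact Finset.sum_congr rfl fun σ _ ↦ by ring
  -- The part symmetric in the last two slots drops out, so under the signed sum the second term of
  -- `dm` may be replaced by the first.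
  have h3 : ∑ σ : Equiv.Perm (Fin (1 + (2 * k + 2))), (Equiv.Perm.sign σ : ℝ) *
      (g y ![e (σ ⟨0, by omega⟩)] *
        (∏ i : Fin k, extDeriv l y ![e (σ ⟨2 * i + 1, by omega⟩), e (σ ⟨2 * i + 2, by omega⟩)]) *
        (fderiv ℝ (fun z ↦ m z ![e (σ ⟨2 * k + 2, by omega⟩)]) y (e (σ ⟨2 * k + 1, by omega⟩)) +
         fderiv ℝ (fun z ↦ m z ![e (σ ⟨2 * k + 1, by omega⟩)]) y (e (σ ⟨2 * k + 2, by omega⟩)))) =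
      0 := by
    refine sum_sign_mul_eq_zero _ (i := ⟨2 * k + 1, by omega⟩) (j := ⟨2 * k + 2, by omega⟩)
      (Fin.ne_of_val_ne (by dsimp only; omega)) fun σ ↦ ?_
    rw [left, right, fix σ (x := ⟨0, _⟩) (by dsimp only; omega) (by dsimp only; omega),
      add_comm (fderiv ℝ _ _ _)]
    congr 2
    refine Finset.prod_congr rfl fun i _ ↦ ?_
    rw [fix σ (by dsimp only; omega) (by dsimp only; omega),
      fix σ (by dsimp only; omega) (by dsimp only; omega)]
  rw [contactWedge_apply, mul_comm (2 : ℝ), mul_assoc]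
  congr 1
  simp only [fderiv_contactPrimitive hU hg hl hm k _ hy, Function.comp_apply, mul_add, Finset.sum_add_distrib, h1, h2, zero_add]
  rw [Finset.mul_sum, ← sub_eq_zero, ← Finset.sum_sub_distrib, ← neg_eq_zero,
    ← Finset.sum_neg_distrib, ← h3]
  refine Finset.sum_congr rfl fun σ _ ↦ ?_
  have h4 := extDeriv_apply_pair (hd hm) (e (σ ⟨2 * k + 1, by omega⟩)) (e (σ ⟨2 * k + 2, by omega⟩))
  simp only [contactTerm, Function.comp_apply, ContinuousAlternatingMap.coe_toAlternatingMap, h4]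
  ring

/-- Stokes' theorem for `g ∧ m ∧ (d l) ^ k` on an open set, for `g` closed and `m` with compact
support. -/
theorem setIntegral_contactWedge_eq_zero [FiniteDimensional ℝ E] [MeasurableSpace E] [BorelSpace E]
    (μ : Measure E) [μ.IsAddHaarMeasure] (hU : IsOpen U) {K : Set E} (hK : IsCompact K)
    (hKU : K ⊆ U) {s : E → ℝ} (hs : ∀ y ∈ U, ∀ᶠ z in 𝓝 y, s z = s y)
    (hg : ContDiffOn ℝ ∞ g U) (hl : ContDiffOn ℝ ∞ l U) (hm : ContDiffOn ℝ ∞ m U)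
    (hdg : ∀ y ∈ U, extDeriv g y = 0) (hmK : ∀ y ∈ U, y ∉ K → m y = 0) (k : ℕ)
    (e : Fin (1 + (2 * k + 2)) → E) :
    ∫ y in U, s y * contactWedge (g y).toAlternatingMap (extDeriv l y).toAlternatingMap
      (extDeriv m y).toAlternatingMap k e ∂μ = 0 := by
  have hint : ∀ σ : Equiv.Perm (Fin (1 + (2 * k + 2))), _ := fun σ ↦
    setIntegral_locallyConstant_mul_fderiv μ hU hK hKU hs
      ((contDiffOn_contactPrimitive hU hg hl hm k (e ∘ σ)).of_le (by simp))
      (fun y hy hyK ↦ by simp [contactPrimitive, hmK y hy hyK])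
      (e (σ ⟨2 * k + 1, by omega⟩))
  have hc : ∀ y ∈ U, s y * contactWedge (g y).toAlternatingMap (extDeriv l y).toAlternatingMap
      (extDeriv m y).toAlternatingMap k e = ∑ σ : Equiv.Perm (Fin (1 + (2 * k + 2))),
        (2 * (1 / 2) ^ (k + 1) * (Equiv.Perm.sign σ : ℝ)) * (s y *
        fderiv ℝ (contactPrimitive g l m k (e ∘ σ)) y (e (σ ⟨2 * k + 1, by omega⟩))) := by
    intro y hy
    rw [contactWedge_eq_sum_fderiv hU hg hl hm hdg k e hy, Finset.mul_sum, Finset.mul_sum]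
    exact Finset.sum_congr rfl fun σ _ ↦ by ring
  rw [setIntegral_congr_fun hU.measurableSet hc, integral_finsetSum]
  · refine Finset.sum_eq_zero fun σ _ ↦ ?_
    rw [integral_const_mul, (hint σ).2, mul_zero]
  · exact fun σ _ ↦ (hint σ).1.const_mul _

end Divergence

/-! ### Wedge products in charts and their signs. -/

section Charts

open MeasureTheory

variable {E : Type*} [NormedAddCommGroup E] [NormedSpace ℝ E]

theorem continuousOn_contactWedge {g : E → E [⋀^Fin 1]→L[ℝ] ℝ} {b c : E → E [⋀^Fin 2]→L[ℝ] ℝ}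
    {U : Set E} (hg : ContDiffOn ℝ ∞ g U) (hb : ContDiffOn ℝ ∞ b U) (hc : ContDiffOn ℝ ∞ c U)
    (k : ℕ) (e : Fin (1 + (2 * k + 2)) → E) :
    ContinuousOn (fun y ↦ contactWedge (g y).toAlternatingMap (b y).toAlternatingMap
      (c y).toAlternatingMap k e) U := by
  simp only [contactWedge_apply, contactTerm, ContinuousAlternatingMap.coe_toAlternatingMap]
  refine continuousOn_const.mul (continuousOn_finsetSum _ fun σ _ ↦ continuousOn_const.mul ?_)
  exact (((contDiffOn_apply_const hg _).continuousOn).mul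
    (continuousOn_finsetProd _ fun _ _ ↦ (contDiffOn_apply_const hb _).continuousOn)).mul
    (contDiffOn_apply_const hc _).continuousOn

theorem integrableOn_of_continuousOn {E : Type*} [NormedAddCommGroup E] [MeasurableSpace E] [BorelSpace E] (μ : Measure E)
    [IsFiniteMeasureOnCompacts μ] {U K : Set E} (hU : IsOpen U) (hK : IsCompact K) (hKU : K ⊆ U)
    {f : E → ℝ} (hf : ContinuousOn f U) (hfK : ∀ y ∈ U, y ∉ K → f y = 0) : IntegrableOn f U μ :=
  ((hf.mono hKU).integrableOn_compact hK).of_forall_sdiff_eq_zero hU.measurableSet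
    fun y hy ↦ hfK y hy.1 hy.2

variable {M : Type*} [TopologicalSpace M] [ChartedSpace E M] {k : ℕ}

/-- The value of `g ∧ b ^ k ∧ c` on the tuple `e`, in the chart around `p`. -/
def chartWedge (g : FormField E M 1) (b c : FormField E M 2) (k : ℕ)
    (e : Fin (1 + (2 * k + 2)) → E) (p : M) (y : E) : ℝ :=
  contactWedge (g.inChart p y).toAlternatingMap (b.inChart p y).toAlternatingMap
    (c.inChart p y).toAlternatingMap k e

theorem chartWedge_sum {ι : Type*} (s : Finset ι) (g : FormField E M 1) (b : FormField E M 2)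
    (c : ι → FormField E M 2) (e : Fin (1 + (2 * k + 2)) → E) (p : M) (y : E) :
    chartWedge g b (∑ i ∈ s, c i) k e p y = ∑ i ∈ s, chartWedge g b (c i) k e p y := by
  induction s using Finset.cons_induction with
  | empty =>
    have h : ((0 : FormField E M 2).inChart p y).toAlternatingMap = 0 := rfl
    rw [Finset.sum_empty, Finset.sum_empty, chartWedge, h, contactWedge_zero]
  | cons a s ha ih =>
    rw [Finset.sum_cons, Finset.sum_cons, ← ih]
    have h : ((c a + ∑ i ∈ s, c i).inChart p y).toAlternatingMap =
      ((c a).inChart p y).toAlternatingMap + ((∑ i ∈ s, c i).inChart p y).toAlternatingMap := rfl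
    rw [chartWedge, h, contactWedge_add]
    rfl

/-- Every top-degree form is a multiple of the determinant of the basis. -/
theorem alternatingMap_comp_basis {ι : Type*} [Fintype ι] [DecidableEq ι] {V : Type*}
    [AddCommGroup V] [Module ℝ V] (e : Module.Basis ι ℝ V) (w : V [⋀^ι]→ₗ[ℝ] ℝ) (f : V →ₗ[ℝ] V) :
    w (f ∘ e) = LinearMap.det f * w e := by
  rw [w.eq_smul_basis_det e]
  simp only [AlternatingMap.smul_apply, e.det_comp, e.det_self, smul_eq_mul]
  ring

theorem contactWedge_compContinuousLinearMap (g : E [⋀^Fin 1]→L[ℝ] ℝ) (b c : E [⋀^Fin 2]→L[ℝ] ℝ)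
    (L : E →L[ℝ] E) (e : Module.Basis (Fin (1 + (2 * k + 2))) ℝ E) :
    contactWedge (g.compContinuousLinearMap L).toAlternatingMap
      (b.compContinuousLinearMap L).toAlternatingMap
      (c.compContinuousLinearMap L).toAlternatingMap k e =
    L.det * contactWedge g.toAlternatingMap b.toAlternatingMap c.toAlternatingMap k e := by
  have h : ∀ {j : ℕ} (a : E [⋀^Fin j]→L[ℝ] ℝ), (a.compContinuousLinearMap L).toAlternatingMap =
    a.toAlternatingMap.compLinearMap L.toLinearMap := fun _ ↦ rfl
  rw [h, h, h, contactWedge_compLinearMap]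
  exact alternatingMap_comp_basis e _ _

theorem continuousOn_chartWedge (g : DiffForm E M 1) (b c : DiffForm E M 2)
    (e : Fin (1 + (2 * k + 2)) → E) (p : M) :
    ContinuousOn (chartWedge g.1 b.1 c.1 k e p) (chartAt E p).target :=
  continuousOn_contactWedge (g.2 p) (b.2 p) (c.2 p) k e

variable [IsManifold 𝓘(ℝ, E) ∞ M]

theorem chartWedge_transition (g : FormField E M 1) (b c : FormField E M 2)
    (e : Module.Basis (Fin (1 + (2 * k + 2))) ℝ E) (p q : M) {y : E}
    (hy : y ∈ (chartAt E p).target) (hq : (chartAt E p).symm y ∈ (chartAt E q).source) :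
    chartWedge g b c k e p y = (fderiv ℝ (chartAt E q ∘ (chartAt E p).symm) y).det *
      chartWedge g b c k e q ((chartAt E q ∘ (chartAt E p).symm) y) := by
  rw [chartWedge, g.inChart_transition p q hy hq, b.inChart_transition p q hy hq,
    c.inChart_transition p q hy hq, contactWedge_compContinuousLinearMap]
  rfl

/-- The derivative of the inverse chart is invertible, so the value at a basis only changes by a
non-zero determinant. -/
theorem chartWedge_ne_zero {g : FormField E M 1} {b c : FormField E M 2}
    (h : ∀ x, contactWedge (g x).toAlternatingMap (b x).toAlternatingMap
      (c x).toAlternatingMap k ≠ 0)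
    (e : Module.Basis (Fin (1 + (2 * k + 2))) ℝ E) (p : M) {y : E}
    (hy : y ∈ (chartAt E p).target) : chartWedge g b c k e p y ≠ 0 := by
  have hL := (mdifferentiable_chart (I := 𝓘(ℝ, E)) p).comp_symm_deriv hy
  let L : E →L[ℝ] E := mfderiv 𝓘(ℝ, E) 𝓘(ℝ, E) (chartAt E p).symm y
  let L' : E →L[ℝ] E := mfderiv 𝓘(ℝ, E) 𝓘(ℝ, E) (chartAt E p) ((chartAt E p).symm y)
  have hdet : L.det ≠ 0 := by
    intro h0
    have h1 : L'.toLinearMap ∘ₗ L.toLinearMap = LinearMap.id :=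
      congrArg ContinuousLinearMap.toLinearMap hL
    have h2 := congrArg LinearMap.det h1
    rw [LinearMap.det_comp, LinearMap.det_id] at h2
    exact right_ne_zero_of_mul (h2 ▸ one_ne_zero) h0
  let g' : E [⋀^Fin 1]→L[ℝ] ℝ := g ((chartAt E p).symm y)
  let b' : E [⋀^Fin 2]→L[ℝ] ℝ := b ((chartAt E p).symm y)
  let c' : E [⋀^Fin 2]→L[ℝ] ℝ := c ((chartAt E p).symm y)
  have hw : chartWedge g b c k e p y = L.det *
      contactWedge g'.toAlternatingMap b'.toAlternatingMap c'.toAlternatingMap k e :=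
    contactWedge_compContinuousLinearMap g' b' c' L e
  rw [hw]
  exact mul_ne_zero hdet ((AlternatingMap.map_basis_ne_zero_iff e _).2 (h _))

/-- The function `sign (g ∧ b ^ (k + 1)) * (g ∧ b ^ k ∧ c)`, in the charts. -/
def signedWedge (g : FormField E M 1) (b c : FormField E M 2) (k : ℕ)
    (e : Fin (1 + (2 * k + 2)) → E) (p : M) (y : E) : ℝ :=
  (SignType.sign (chartWedge g b b k e p y) : ℝ) * chartWedge g b c k e p y

/-- Under a change of charts the form gains the factor `det` and the sign of `g ∧ b ^ (k + 1)` gains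
`sign det`; their product is `|det|`, so no orientation is needed. -/
theorem isDensity_signedWedge (g : FormField E M 1) (b c : FormField E M 2)
    (e : Module.Basis (Fin (1 + (2 * k + 2))) ℝ E) : IsDensity E M (signedWedge g b c k e) := by
  intro p q y hy hq
  simp only [signedWedge, chartWedge_transition g b _ e p q hy hq, sign_mul, SignType.coe_mul,
    ← sign_mul_self (fderiv ℝ (chartAt E q ∘ (chartAt E p).symm) y).det]
  ring

/-- A continuous function has locally constant sign where it does not vanish. This makes the sign an
admissible factor `s` in `setIntegral_contactWedge_eq_zero`. -/
theorem sign_chartWedge_eventually_eq {g : DiffForm E M 1} {b : DiffForm E M 2}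
    (h : ∀ x, contactWedge (g.1 x).toAlternatingMap (b.1 x).toAlternatingMap
      (b.1 x).toAlternatingMap k ≠ 0)
    (e : Module.Basis (Fin (1 + (2 * k + 2))) ℝ E) (p : M) {y : E}
    (hy : y ∈ (chartAt E p).target) :
    ∀ᶠ z in 𝓝 y, (SignType.sign (chartWedge g.1 b.1 b.1 k e p z) : ℝ) =
      SignType.sign (chartWedge g.1 b.1 b.1 k e p y) := by
  have h1 : ContinuousAt (fun z ↦ SignType.sign (chartWedge g.1 b.1 b.1 k e p z)) y :=
    (continuousAt_sign_of_ne_zero (chartWedge_ne_zero h e p hy)).comp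
      ((continuousOn_chartWedge g b b e p).continuousAt ((chartAt E p).open_target.mem_nhds hy))
  filter_upwards [h1.eventually (isOpen_discrete {SignType.sign
    (chartWedge g.1 b.1 b.1 k e p y)} |>.mem_nhds rfl)] with z hz
  rw [show SignType.sign (chartWedge g.1 b.1 b.1 k e p z) = _ from hz]

theorem continuousOn_signedWedge {g : DiffForm E M 1} {b : DiffForm E M 2}
    (h : ∀ x, contactWedge (g.1 x).toAlternatingMap (b.1 x).toAlternatingMap
      (b.1 x).toAlternatingMap k ≠ 0) (c : DiffForm E M 2)
    (e : Module.Basis (Fin (1 + (2 * k + 2))) ℝ E) (p : M) :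
    ContinuousOn (signedWedge g.1 b.1 c.1 k e p) (chartAt E p).target := by
  refine ContinuousOn.mul (fun y hy ↦ ContinuousAt.continuousWithinAt ?_)
    (continuousOn_chartWedge g b c e p)
  exact continuousAt_const.congr
    ((sign_chartWedge_eventually_eq h e p hy).mono fun z hz ↦ hz.symm)

theorem contDiffOn_comp_chartAt_symm {f : M → ℝ} (hf : ContMDiff 𝓘(ℝ, E) 𝓘(ℝ) ∞ f) (p : M) :
    ContDiffOn ℝ ∞ (fun y ↦ f ((chartAt E p).symm y)) (chartAt E p).target :=
  (hf.comp_contMDiffOn (contMDiffOn_chart_symm (I := 𝓘(ℝ, E)) (x := p))).contDiffOn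

/-- The product of a smooth function with a smooth form. -/
def DiffForm.funSmul (f : M → ℝ) (hf : ContMDiff 𝓘(ℝ, E) 𝓘(ℝ) ∞ f) {j : ℕ} (a : DiffForm E M j) :
    DiffForm E M j :=
  ⟨fun x ↦ f x • a.1 x, fun p ↦ (contDiffOn_comp_chartAt_symm hf p).smul (a.2 p)⟩

theorem DiffForm.inChart_funSmul (f : M → ℝ) (hf : ContMDiff 𝓘(ℝ, E) 𝓘(ℝ) ∞ f) {j : ℕ}
    (a : DiffForm E M j) (p : M) (y : E) :
    (DiffForm.funSmul f hf a).1.inChart p y = f ((chartAt E p).symm y) • a.1.inChart p y := rfl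

theorem DiffForm.inChart_d_funSmul_eq_zero (f : M → ℝ) (hf : ContMDiff 𝓘(ℝ, E) 𝓘(ℝ) ∞ f) {j : ℕ}
    (a : DiffForm E M j) (p : M) {y : E} (hy : y ∈ (chartAt E p).target)
    (hfy : (chartAt E p).symm y ∉ tsupport f) :
    (DiffForm.d (DiffForm.funSmul f hf a)).1.inChart p y = 0 := by
  have h : (DiffForm.funSmul f hf a).1.inChart p =ᶠ[𝓝 y] 0 := by
    filter_upwards [((chartAt E p).continuousAt_symm hy).eventually
      ((isClosed_tsupport f).isOpen_compl.mem_nhds hfy)] with z hz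
    rw [DiffForm.inChart_funSmul, image_eq_zero_of_notMem_tsupport hz, zero_smul, Pi.zero_apply]
  change (FormField.d (DiffForm.funSmul f hf a).1).inChart p y = 0
  rw [FormField.inChart_d (DiffForm.funSmul f hf a).2 p hy, h.extDeriv_eq]
  rw [extDeriv, fderiv_zero]
  exact map_zero (ContinuousAlternatingMap.alternatizeUncurryFinCLM ℝ E ℝ)

end Charts

/-! ### Global Stokes argument with a partition of unity. -/

section Stokes

open MeasureTheory

theorem isCompact_chartAt_image {E : Type*} [TopologicalSpace E] {M : Type*} [TopologicalSpace M]
    [ChartedSpace E M] [CompactSpace M] {f : M → ℝ} {p : M}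
    (hf : tsupport f ⊆ (chartAt E p).source) : IsCompact (chartAt E p '' tsupport f) ∧
      chartAt E p '' tsupport f ⊆ (chartAt E p).target ∧
      ∀ y ∈ (chartAt E p).target, y ∉ chartAt E p '' tsupport f →
        (chartAt E p).symm y ∉ tsupport f := by
  refine ⟨(isClosed_tsupport f).isCompact.image_of_continuousOn
    ((chartAt E p).continuousOn.mono hf), ?_, fun y hy hyK h ↦ hyK ⟨_, h, (chartAt E p).right_inv hy⟩⟩
  rintro _ ⟨x, hx, rfl⟩
  exact (chartAt E p).map_source (hf hx)

variable {E : Type*} [NormedAddCommGroup E] [NormedSpace ℝ E] [FiniteDimensional ℝ E]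
  {M : Type*} [TopologicalSpace M] [ChartedSpace E M] [IsManifold 𝓘(ℝ, E) ∞ M] {k : ℕ}

/-- In the chart around `p`, the integral of `g ∧ (d l) ^ k ∧ d (f l)` vanishes if `g` is closed and
`f` is supported in the domain of the chart. -/
theorem setIntegral_signedWedge_eq_zero [MeasurableSpace E] [BorelSpace E] (μ : Measure E)
    [μ.IsAddHaarMeasure] [CompactSpace M] {g l : DiffForm E M 1} (hg : DiffForm.d g = 0)
    (h : ∀ x, contactWedge (g.1 x).toAlternatingMap ((DiffForm.d l).1 x).toAlternatingMap
      ((DiffForm.d l).1 x).toAlternatingMap k ≠ 0)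
    (e : Module.Basis (Fin (1 + (2 * k + 2))) ℝ E) (p : M) {f : M → ℝ}
    (hf : ContMDiff 𝓘(ℝ, E) 𝓘(ℝ) ∞ f) (hfp : tsupport f ⊆ (chartAt E p).source) :
    ∫ y in (chartAt E p).target,
      signedWedge g.1 (DiffForm.d l).1 (DiffForm.d (DiffForm.funSmul f hf l)).1 k e p y ∂μ = 0 := by
  obtain ⟨hK, hKU, hKf⟩ := isCompact_chartAt_image hfp
  have hU := (chartAt E p).open_target
  rw [← setIntegral_contactWedge_eq_zero μ hU hK hKU
    (fun y hy ↦ sign_chartWedge_eventually_eq h e p hy) (g.2 p) (l.2 p)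
    ((DiffForm.funSmul f hf l).2 p) _ _ k e]
  · refine setIntegral_congr_fun hU.measurableSet fun y hy ↦ ?_
    simp only [signedWedge]
    rw [chartWedge.eq_def g.1 (DiffForm.d l).1 (DiffForm.d (DiffForm.funSmul f hf l)).1,
      ← FormField.inChart_d l.2 p hy, ← FormField.inChart_d (DiffForm.funSmul f hf l).2 p hy]
    rfl
  · intro y hy
    rw [← FormField.inChart_d g.2 p hy]
    exact congrArg (fun a : DiffForm E M 2 ↦ a.1.inChart p y) hg
  · intro y hy hyK
    rw [DiffForm.inChart_funSmul, image_eq_zero_of_notMem_tsupport (hKf y hy hyK), zero_smul]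

/-- On a closed manifold, `g ∧ (d l) ^ (k + 1)` cannot be a volume form if `g` is closed. -/
theorem not_forall_contactWedge_ne_zero [T2Space M] [CompactSpace M] [Nonempty M]
    (e : Module.Basis (Fin (1 + (2 * k + 2))) ℝ E) {g l : DiffForm E M 1} (hg : DiffForm.d g = 0) :
    ¬ ∀ x, contactWedge (g.1 x).toAlternatingMap ((DiffForm.d l).1 x).toAlternatingMap
      ((DiffForm.d l).1 x).toAlternatingMap k ≠ 0 := by
  intro h
  borelize E
  let μ : Measure E := Measure.addHaar
  obtain ⟨t, ht⟩ := isCompact_univ.elim_finite_subcover (fun p : M ↦ (chartAt E p).source)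
    (fun p ↦ (chartAt E p).open_source)
    (fun x _ ↦ Set.mem_iUnion.2 ⟨x, mem_chart_source E x⟩)
  obtain ⟨ρ, hρ⟩ := SmoothPartitionOfUnity.exists_isSubordinate 𝓘(ℝ, E) isClosed_univ
    (fun p : t ↦ (chartAt E (p : M)).source) (fun p ↦ (chartAt E (p : M)).open_source)
    (fun x hx ↦ by
      obtain ⟨p, hp, hx⟩ := Set.mem_iUnion₂.1 (ht hx)
      exact Set.mem_iUnion.2 ⟨⟨p, hp⟩, hx⟩)
  have hsum : ∀ x, ∑ i, ρ i x = 1 := fun x ↦ by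
    rw [← finsum_eq_sum_of_fintype]
    exact ρ.sum_eq_one (Set.mem_univ x)
  set b := DiffForm.d l with hb
  let c : t → DiffForm E M 2 := fun j ↦ DiffForm.d (DiffForm.funSmul (ρ j) (ρ j).contMDiff l)
  -- The partition of unity is used twice: here to cut `l`, and hence the last factor `dl`, into
  -- pieces supported in charts; later, with index `i`, to define the global integral.
  have hl : l = ∑ j, DiffForm.funSmul (ρ j) (ρ j).contMDiff l := by
    refine Subtype.ext (funext fun x ↦ ?_)
    rw [AddSubmonoidClass.coe_finsetSum]
    have h1 : (∑ j, (DiffForm.funSmul (ρ j) (ρ j).contMDiff l).1) x = ∑ j, ρ j x • l.1 x :=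
      Finset.sum_apply x Finset.univ fun j ↦ (DiffForm.funSmul (ρ j) (ρ j).contMDiff l).1
    rw [h1, ← Finset.sum_smul, hsum, one_smul]
  have hbc : b.1 = ∑ j, (c j).1 := by
    rw [← AddSubmonoidClass.coe_finsetSum, ← map_sum, ← hl]
  have hsw : ∀ p y, signedWedge g.1 b.1 b.1 k e p y = ∑ j, signedWedge g.1 b.1 (c j).1 k e p y := by
    intro p y
    simp only [signedWedge]
    rw [← Finset.mul_sum, ← chartWedge_sum, ← hbc]
  have hsub : ∀ i, tsupport (ρ i) ⊆ (chartAt E (i : M)).source := hρ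
  have hc0 : ∀ (j : t) (p : M), ∀ y ∈ (chartAt E p).target,
      (chartAt E p).symm y ∉ tsupport (ρ j) → signedWedge g.1 b.1 (c j).1 k e p y = 0 := by
    intro j p y hy hj
    have h0 := DiffForm.inChart_d_funSmul_eq_zero (ρ j) (ρ j).contMDiff l p hy hj
    have h1 : ((c j).1.inChart p y).toAlternatingMap = 0 :=
      congrArg ContinuousAlternatingMap.toAlternatingMap h0
    rw [signedWedge, chartWedge.eq_def _ _ (c j).1, h1, contactWedge_zero, mul_zero]
  have hcont : ∀ (i : t) (c : DiffForm E M 2) (p : M),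
      ContinuousOn (fun y ↦ ρ i ((chartAt E p).symm y) * signedWedge g.1 b.1 c.1 k e p y)
        (chartAt E p).target := fun i c p ↦
    (contDiffOn_comp_chartAt_symm (ρ i).contMDiff p).continuousOn.mul
      (continuousOn_signedWedge h c e p)
  have hint : ∀ (i : t) (c : DiffForm E M 2),
      IntegrableOn (fun y ↦ ρ i ((chartAt E (i : M)).symm y) * signedWedge g.1 b.1 c.1 k e i y)
        (chartAt E (i : M)).target μ := by
    intro i c
    obtain ⟨hK, hKU, hKf⟩ := isCompact_chartAt_image (hsub i)
    refine integrableOn_of_continuousOn μ (chartAt E (i : M)).open_target hK hKU (hcont i c i) ?_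
    intro y hy hyK
    rw [image_eq_zero_of_notMem_tsupport (hKf y hy hyK), zero_mul]
  have hint' : ∀ i j : t,
      IntegrableOn (fun y ↦ ρ i ((chartAt E (j : M)).symm y) * signedWedge g.1 b.1 (c j).1 k e j y)
        (chartAt E (j : M)).target μ := by
    intro i j
    obtain ⟨hK, hKU, hKf⟩ := isCompact_chartAt_image (hsub j)
    refine integrableOn_of_continuousOn μ (chartAt E (j : M)).open_target hK hKU
      (hcont i (c j) j) ?_
    intro y hy hyK
    rw [hc0 j j y hy (hKf y hy hyK), mul_zero]
  -- The integrand vanishes off the overlap of the two charts: `ρ i` is supported in the first and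
  -- `d(ρ j • l)` in the second.
  have hchange : ∀ i j : t,
      ∫ y in (chartAt E (i : M)).target,
        ρ i ((chartAt E (i : M)).symm y) * signedWedge g.1 b.1 (c j).1 k e i y ∂μ =
      ∫ y in (chartAt E (j : M)).target,
        ρ i ((chartAt E (j : M)).symm y) * signedWedge g.1 b.1 (c j).1 k e j y ∂μ := by
    intro i j
    refine ((isDensity_signedWedge g.1 b.1 (c j).1 e).mul (ρ i)).setIntegral_eq μ i j ?_ ?_
    · intro y hy hyj
      rw [hc0 j i y hy fun hj ↦ hyj (hsub j hj), mul_zero]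
    · intro y hy hyi
      rw [image_eq_zero_of_notMem_tsupport fun hi ↦ hyi (hsub i hi), zero_mul]
  -- Once all terms with index `j` are moved to chart `j`, the factors `ρ i` sum to `1`, leaving the
  -- integral of a divergence with compact support.
  have htotal : ∑ i : t, ∫ y in (chartAt E (i : M)).target,
      ρ i ((chartAt E (i : M)).symm y) * signedWedge g.1 b.1 b.1 k e i y ∂μ = 0 := by
    calc
      _ = ∑ i : t, ∑ j : t, ∫ y in (chartAt E (i : M)).target,
          ρ i ((chartAt E (i : M)).symm y) * signedWedge g.1 b.1 (c j).1 k e i y ∂μ := by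
        refine Finset.sum_congr rfl fun i _ ↦ ?_
        simp only [hsw, Finset.mul_sum]
        exact integral_finsetSum _ fun j _ ↦ hint i (c j)
      _ = ∑ j : t, ∑ i : t, ∫ y in (chartAt E (j : M)).target,
          ρ i ((chartAt E (j : M)).symm y) * signedWedge g.1 b.1 (c j).1 k e j y ∂μ := by
        rw [Finset.sum_comm]
        exact Finset.sum_congr rfl fun j _ ↦ Finset.sum_congr rfl fun i _ ↦ hchange i j
      _ = 0 := by
        refine Finset.sum_eq_zero fun j _ ↦ ?_
        rw [← integral_finsetSum _ fun i _ ↦ hint' i j]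
        simp only [← Finset.sum_mul, hsum, one_mul]
        exact setIntegral_signedWedge_eq_zero μ hg h e j (ρ j).contMDiff (hsub j)
  have hpos : ∀ (i : t) (y : E),
      0 ≤ ρ i ((chartAt E (i : M)).symm y) * signedWedge g.1 b.1 b.1 k e i y := by
    intro i y
    rw [signedWedge, sign_mul_self]
    exact mul_nonneg (ρ.nonneg i _) (abs_nonneg _)
  rw [Finset.sum_eq_zero_iff_of_nonneg fun i _ ↦ integral_nonneg (hpos i)] at htotal
  -- A continuous non-negative integrand with zero integral vanishes on the chart. Since the form
  -- has no zeros, `ρ i` must vanish, contradicting that the `ρ i` sum to `1`.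
  have hρ0 : ∀ (i : t) (x : M), ρ i x = 0 := by
    intro i x
    by_cases hx : x ∈ (chartAt E (i : M)).source
    · have h1 := (setIntegral_eq_zero_iff_of_nonneg_ae (Filter.Eventually.of_forall (hpos i))
        (hint i b)).1 (htotal i (Finset.mem_univ i))
      have h2 := Measure.eqOn_open_of_ae_eq h1 (chartAt E (i : M)).open_target (hcont i b i)
        continuousOn_const ((chartAt E (i : M)).map_source hx)
      simp only [(chartAt E (i : M)).left_inv hx, signedWedge, sign_mul_self, Pi.zero_apply,
        mul_eq_zero, abs_eq_zero] at h2
      exact h2.resolve_right (chartWedge_ne_zero h e i ((chartAt E (i : M)).map_source hx))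
    · exact image_eq_zero_of_notMem_tsupport fun h ↦ hx (hsub i h)
  obtain ⟨x⟩ := ‹Nonempty M›
  have := hsum x
  simp [hρ0] at this

end Stokes

/-! ### The contact-type obstruction. -/

section Obstruction

variable {n : ℕ} {M : Type*} [TopologicalSpace M]
  [ChartedSpace (EuclideanSpace ℝ (Fin (2 * n + 1))) M]
  [IsManifold (𝓡 (2 * n + 1)) ∞ M] [T2Space M] [CompactSpace M] [Nonempty M]

/-- The basic class of the differential of a contact form does not vanish. -/
theorem IsContact.reebClass_ne_zero (hn : 1 ≤ n)
    {l : DiffForm (EuclideanSpace ℝ (Fin (2 * n + 1))) M 1} (hl : IsContact l) :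
    reebClass (DiffForm.d l) (DiffForm.d_d l) ≠ 0 := by
  intro h0
  obtain ⟨a, ⟨ha, -⟩, hda⟩ : DiffForm.d l ∈ basicCoboundaries (reebBundle (DiffForm.d l)) 2 :=
    (Submodule.Quotient.mk_eq_zero ((basicCoboundaries (reebBundle (DiffForm.d l)) 2).submoduleOf
      (basicCocycles (reebBundle (DiffForm.d l)) 2))).1 h0
  -- Since `n ≥ 1`, one factor `dl` can be split off `(dl)^n`, to be integrated by parts.
  obtain ⟨k, rfl⟩ : ∃ k, n = k + 1 := ⟨n - 1, by omega⟩
  let e₀ := (EuclideanSpace.basisFun (Fin (2 * (k + 1) + 1)) ℝ).toBasis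
  let e : Module.Basis (Fin (1 + (2 * k + 2))) ℝ (EuclideanSpace ℝ (Fin (2 * (k + 1) + 1))) :=
    e₀.reindex (finCongr (by omega))
  have hg : DiffForm.d (l - a) = 0 := by rw [map_sub, hda, sub_self]
  refine not_forall_contactWedge_ne_zero (k := k) e hg (l := l) fun x h ↦ hl x ?_
  let lx : EuclideanSpace ℝ (Fin (2 * (k + 1) + 1)) [⋀^Fin 1]→L[ℝ] ℝ := l.1 x
  let ax : EuclideanSpace ℝ (Fin (2 * (k + 1) + 1)) [⋀^Fin 1]→L[ℝ] ℝ := a.1 x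
  let bx : EuclideanSpace ℝ (Fin (2 * (k + 1) + 1)) [⋀^Fin 2]→L[ℝ] ℝ := (DiffForm.d l).1 x
  -- A non-zero Reeb vector at `x`, which exists because the dimension is odd.
  obtain ⟨r, hr, hb⟩ := exists_ne_zero_forall_eq_zero (by simp) e₀ bx.toAlternatingMap
  have hrF : r ∈ reebBundle (DiffForm.d l) x := by
    refine AlternatingMap.ext fun v ↦ ?_
    have hv : v = ![v 0] := by
      ext i
      fin_cases i
      rfl
    rw [hv]
    exact hb (v 0)
  have har : ax.toAlternatingMap ![r] = 0 := ha x ![r] ⟨0, hrF⟩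
  have h1 := contactWedge_eq_zero (k := k) e _ _ _ hr har hb hb
  -- The recursion of `wedgePow` at `k + 1` makes the form in `IsContact` definitionally a
  -- `contactWedge` with equal last two arguments.
  change contactWedge lx.toAlternatingMap bx.toAlternatingMap bx.toAlternatingMap k = 0
  have h2 : contactWedge (lx.toAlternatingMap - ax.toAlternatingMap) bx.toAlternatingMap
    bx.toAlternatingMap k = 0 := h
  ext v
  have h3 := contactWedge_sub lx.toAlternatingMap ax.toAlternatingMap bx.toAlternatingMap
    bx.toAlternatingMap k v
  rw [h1, h2] at h3
  simpa using h3.symm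

end Obstruction

end Presymplectic

end

theorem theorem5p1 (n : ℕ) (hn : 1 ≤ n) (M : Type*) [TopologicalSpace M]
    [ChartedSpace (EuclideanSpace ℝ (Fin (2 * n + 1))) M]
    [IsManifold (𝓡 (2 * n + 1)) ∞ M]
    [T2Space M] [CompactSpace M] [Nonempty M] :
    (∀ l : Presymplectic.DiffForm (EuclideanSpace ℝ (Fin (2 * n + 1))) M 1,
      Presymplectic.IsContact l →
        Presymplectic.reebClass (Presymplectic.DiffForm.d l)
          (Presymplectic.DiffForm.d_d l) ≠ 0) ∧
    (∀ (w : Presymplectic.DiffForm (EuclideanSpace ℝ (Fin (2 * n + 1))) M 2)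
      (hw : Presymplectic.IsPresymplectic w),
        Presymplectic.reebClass w hw.closed = 0 → ¬ Presymplectic.IsContactType w) := by
  refine ⟨fun l hl ↦ hl.reebClass_ne_zero hn, ?_⟩
  -- After substituting `w = dl`, the two proofs of closedness in `reebClass` agree by proof
  -- irrelevance.
  rintro _ hw h0 ⟨l, hl, rfl⟩
  exact hl.reebClass_ne_zero hn h0
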